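/- **Setting.** An agent chooses in every period $t=0,1,2,\dots$ an action $a_t$ from a set $\mathcal A$ with exactly two elements and observes an outcome $y_t\in\mathcal Y$. Given $a_t=a$ the outcome is drawn (independently over time) from $Q^*(\cdot\mid a)$, which has a positive density $q^*(\cdot\mid a)$ with respect to a common measure $\nu$; the payoff is $u(a,y)$ with $u(a,\cdot)\in L^1(Q^*(\cdot\mid a))$. Let $\{q(\cdot\mid a,\omega)\}_{a\in\mathcal A,\ \omega\in\Omega^q}$ be a family of positive probability densities with respect to $\nu$, where $\Omega^q$ is any subset of a Euclidean space, such that for all $a$ and all $\omega\in\Omega^q$: $u(a,\cdot)$ is integrable with respect to $q(\cdot\mid a,\omega)\,d\nu$, and $\left|\ln\frac{q^*(\cdot\mid a)}{q(\cdot\mid a,\omega)}\right|$ is bounded $Q^*(\cdot\mid a)$-a.s. by a function in $L^2(Q^*(\cdot\mid a))$. A *model* $\theta$ in the family $\Theta^q$ is given by a nonempty finite parameter set $\Omega^\theta\subseteq\Omega^q$. For a belief $\pi\in\Delta\Omega^\theta$ let $A_m^\theta(\pi)$ be the set of actions that maximize $\sum_{\omega}\pi(\omega)\int u(a,y)\,q(y\mid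 a,\omega)\,\nu(dy)$. The agent is myopic (discount factor $\delta=0$): an *optimal policy* for $\theta$ is a map $a^\theta:\Delta\Omega^\theta\to\mathcal A$ with $a^\theta(\pi)\in A_m^\theta(\pi)$ for all $\pi$. **Switching and persistence.** Fix a switching threshold $\alpha>1$. A switcher has an initial model $\theta$ and a competing model $\theta^c$, each with a full-support prior $\pi_0$ and an optimal policy. She starts with $m_0=\theta$. In period $t\ge1$ she computes $l^{\theta'}_t=\sum_{\omega\in\Omega^{\theta'}}\pi^{\theta'}_0(\omega)\prod_{\tau<t}q(y_\tau\mid a_\tau,\omega)$ for both models $\theta'$; if the ratio of the value for the model other than $m_{t-1}$ to the value for $m_{t-1}$ exceeds $\alpha$, then $m_t$ is the other model, and otherwise $m_t=m_{t-1}$. In every period she plays the action that the policy of $m_t$ prescribes at the Bayesian posterior over $\Omega^{m_t}$ given the full history. The model $\theta$ *persists* against $\theta^c$ (at these priors and policies) if $m_t$ converges to $\theta$ with positive probability. **Constrained local robustness.** A model $\theta\in\Theta^q$ is *$q$-constrained locally robust* if there are $\epsilon>0$, a full-support prior $\pi^\theta_0$ and an optimal policy $a^\theta$ under which $\theta$ persists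 against every $\theta^c\in\Theta^q$ with Hausdorff distance $d_H(\Omega^\theta,\Omega^{\theta^c})\le\epsilon$, at every full-support prior $\pi_0^{\theta^c}$ on $\Omega^{\theta^c}$ within Prokhorov distance $\epsilon$ of $\pi_0^\theta$, and at every optimal policy $a^{\theta^c}$. **Equilibrium.** For $\sigma\in\Delta\mathcal A$ let $\Omega^\theta(\sigma)$ be the set of minimizers over $\omega\in\Omega^\theta$ of $\sum_a\sigma(a)\,D_{KL}\big(q^*(\cdot\mid a)\,\|\,q(\cdot\mid a,\omega)\big)$. Then $\sigma$ is a *Berk–Nash equilibrium* under $\theta$ if there is a belief $\pi\in\Delta\Omega^\theta(\sigma)$ such that $\operatorname{supp}\sigma\subseteq A^\theta_m(\pi)$. The model $\theta$ is *locally KL-minimizing at $\sigma$ with respect to $\Omega^q$* if there is $\epsilon>0$ such that for all $\omega\in\Omega^\theta(\sigma)$ and all $\omega'\in\Omega^q$ at distance less than $\epsilon$ from $\Omega^\theta(\sigma)$, $$\sum_{a\in\mathcal A}\sigma(a)\,\mathbb E_{Q^*(\cdot\mid a)}\left[\ln\frac{q(\cdot\mid a,\omega')}{q(\cdot\mid a,\omega)}\right]\le0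 .$$ **Theorem.** Under these assumptions ($|\mathcal A|=2$, $\delta=0$, $\alpha>1$), if a model $\theta\in\Theta^q$ is $q$-constrained locally robust, then there is a Berk–Nash equilibrium $\sigma$ under $\theta$ at which $\theta$ is locally KL-minimizing with respect to $\Omega^q$. -/

import Mathlib

open MeasureTheory

noncomputable section

/-- The objective environment: outcomes in `Y`, actions in `A`, a reference measure `ν`, the true
conditional densities `qstar a` (positive, with respect to `ν`) and the payoff function `u`, which is
integrable under the true distribution. -/
structure Environment (A Y : Type*) [MeasurableSpace Y] where
  ν : Measure Y
  qstar : A → Y → ℝ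
  u : A → Y → ℝ
  measurable_qstar : ∀ a, Measurable (qstar a)
  qstar_pos : ∀ a y, 0 < qstar a y
  lintegral_qstar : ∀ a, ∫⁻ y, ENNReal.ofReal (qstar a y) ∂ν = 1
  integrable_u : ∀ a, Integrable (u a) (ν.withDensity fun y => ENNReal.ofReal (qstar a y))

namespace Environment

variable {A Y : Type*} [MeasurableSpace Y]

/-- The true distribution of the outcome after action `a`. -/
def law (𝓔 : Environment A Y) (a : A) : Measure Y :=
  𝓔.ν.withDensity fun y => ENNReal.ofReal (𝓔.qstar a y)

instance (𝓔 : Environment A Y) (a : A) : IsProbabilityMeasure (𝓔.law a) :=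
  ⟨by simp [law, 𝓔.lintegral_qstar a]⟩

/-- The underlying probability measure: `y (a, t)` is the outcome that is observed if action `a` is
taken in period `t`; all these outcomes are independent and `y (a, t)` has the true distribution
given `a`. -/
def prob (𝓔 : Environment A Y) : Measure (A × ℕ → Y) :=
  Measure.infinitePi fun i : A × ℕ => 𝓔.law i.1

end Environment

/-- Parameters live in a Euclidean space. -/
abbrev Param (n : ℕ) : Type := EuclideanSpace ℝ (Fin n)

/-- A parametric family of action-dependent outcome densities `q a ω`, `ω ∈ params`. Every parameter
satisfies the standing assumptions on subjective models: positive densities, payoffs that are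
integrable under the subjective distributions, and a square-integrable bound on the
log-likelihood ratio against the truth. -/
structure ParamFamily {A Y : Type*} [MeasurableSpace Y] (𝓔 : Environment A Y) (n : ℕ) where
  params : Set (Param n)
  q : A → Param n → Y → ℝ
  measurable_q : ∀ a, ∀ ω ∈ params, Measurable (q a ω)
  q_pos : ∀ a, ∀ ω ∈ params, ∀ y, 0 < q a ω y
  lintegral_q : ∀ a, ∀ ω ∈ params, ∫⁻ y, ENNReal.ofReal (q a ω y) ∂𝓔.ν = 1
  integrable_u : ∀ a, ∀ ω ∈ params,
    Integrable (𝓔.u a) (𝓔.ν.withDensity fun y => ENNReal.ofReal (q a ω y))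
  log_ratio_bound : ∀ a, ∀ ω ∈ params, ∃ g : Y → ℝ, MemLp g 2 (𝓔.law a) ∧
    ∀ᵐ y ∂𝓔.law a, |Real.log (𝓔.qstar a y / q a ω y)| ≤ g y

namespace ParamFamily

variable {A Y : Type*} [MeasurableSpace Y] {𝓔 : Environment A Y} {n : ℕ}

/-- The models of the family are given by their parameter sets, which are the nonempty finite
subsets of the parameter set of the family. -/
def IsModel (F : ParamFamily 𝓔 n) (θ : Finset (Param n)) : Prop :=
  θ.Nonempty ∧ (θ : Set (Param n)) ⊆ F.params

/-- Expected flow payoff of action `a` under the belief `π` over the parameters of `θ`. -/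
def payoff (F : ParamFamily 𝓔 n) (θ : Finset (Param n)) (π : θ → ℝ) (a : A) : ℝ :=
  ∑ ω : θ, π ω * ∫ y, 𝓔.u a y * F.q a ω y ∂𝓔.ν

/-- The set of myopically optimal actions at the belief `π`. -/
def myopicOpt (F : ParamFamily 𝓔 n) (θ : Finset (Param n)) (π : θ → ℝ) : Set A :=
  {a | ∀ b, F.payoff θ π b ≤ F.payoff θ π a}

/-- A (measurable) pure policy that is optimal for a myopic agent, that is, one with discount factor
zero. Only its values at probability vectors matter. -/
def IsOptimalPolicy (F : ParamFamily 𝓔 n) (θ : Finset (Param n)) (p : (θ → ℝ) → A) : Prop :=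
  (∀ a, MeasurableSet {π | p π = a}) ∧ ∀ π ∈ stdSimplex ℝ θ, p π ∈ F.myopicOpt θ π

/-- Kullback-Leibler divergence of the true density from the density of `ω`, given action `a`. -/
def kl (F : ParamFamily 𝓔 n) (a : A) (ω : Param n) : ℝ :=
  ∫ y, 𝓔.qstar a y * Real.log (𝓔.qstar a y / F.q a ω y) ∂𝓔.ν

/-- The minimizers over `θ` of the Kullback-Leibler divergence weighted by the mixed action `σ`. -/
def klMin [Fintype A] (F : ParamFamily 𝓔 n) (θ : Finset (Param n)) (σ : A → ℝ) :
    Set (Param n) :=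
  {ω | ω ∈ θ ∧ ∀ ω' ∈ θ, ∑ a, σ a * F.kl a ω ≤ ∑ a, σ a * F.kl a ω'}

/-- `σ` is a Berk-Nash equilibrium under `θ`: a mixed action whose support consists of myopically
optimal actions at some belief that is concentrated on the divergence minimizers at `σ`. -/
def IsBerkNash [Fintype A] (F : ParamFamily 𝓔 n) (θ : Finset (Param n)) (σ : A → ℝ) : Prop :=
  σ ∈ stdSimplex ℝ A ∧ ∃ π ∈ stdSimplex ℝ θ,
    (∀ ω : θ, π ω ≠ 0 → (ω : Param n) ∈ F.klMin θ σ) ∧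
    ∀ a, σ a ≠ 0 → a ∈ F.myopicOpt θ π

/-- `θ` is locally KL-minimizing at `σ` within the parameter set of the family. -/
def IsLocallyKLMinimizing [Fintype A] (F : ParamFamily 𝓔 n) (θ : Finset (Param n))
    (σ : A → ℝ) : Prop :=
  ∃ ε > 0, ∀ ω ∈ F.klMin θ σ, ∀ ω' ∈ F.params ∩ Metric.thickening ε (F.klMin θ σ),
    ∑ a, σ a * ∫ y, Real.log (F.q a ω' y / F.q a ω y) ∂𝓔.law a ≤ 0

/-- Bayes' rule for beliefs over the parameters of `θ`, after action `x.1` and outcome `x.2`. -/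
def bayes (F : ParamFamily 𝓔 n) (θ : Finset (Param n)) (x : A × Y) (π : θ → ℝ) : θ → ℝ :=
  fun ω => π ω * F.q x.1 ω x.2 / ∑ ω' : θ, π ω' * F.q x.1 ω' x.2

end ParamFamily

/-- A model together with a prior over its parameters and a policy. -/
structure EndowedModel (A : Type*) (n : ℕ) where
  model : Finset (Param n)
  prior : model → ℝ
  policy : (model → ℝ) → A

/-- Full-support probability vectors over the parameters of `θ`. -/
def IsFullSupport {n : ℕ} (θ : Finset (Param n)) (π : θ → ℝ) : Prop :=
  π ∈ stdSimplex ℝ θ ∧ ∀ ω, 0 < π ω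

/-- A belief over the parameters of `θ` as a measure on the parameter space. -/
def beliefMeasure {n : ℕ} (θ : Finset (Param n)) (π : θ → ℝ) : Measure (Param n) :=
  ∑ ω : θ, ENNReal.ofReal (π ω) • Measure.dirac (ω : Param n)

namespace ParamFamily

variable {A Y : Type*} [MeasurableSpace Y] {𝓔 : Environment A Y} {n : ℕ}

/-- Likelihood of a history (most recent period first) under the model and prior of `M`. -/
def likelihood (F : ParamFamily 𝓔 n) (M : EndowedModel A n) (h : List (A × Y)) : ℝ :=
  ∑ ω : M.model, M.prior ω * (h.map fun x => F.q x.1 ω x.2).prod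

/-- Belief over the parameters of `M` after a history (most recent period first). -/
def posterior (F : ParamFamily 𝓔 n) (M : EndowedModel A n) : List (A × Y) → M.model → ℝ
  | [] => M.prior
  | x :: h => F.bayes M.model x (F.posterior M h)

/-- The model choice of a switcher after a history, where `S false` is the initial model and
`S true` is the competing model. The Bayes factor of the current model is `1 < α`, so a switch occurs
exactly if the Bayes factor of the other model exceeds `α`. -/
def modelChoice (F : ParamFamily 𝓔 n) (α : ℝ) (S : Bool → EndowedModel A n) :
    List (A × Y) → Bool
  | [] => false
  | x :: h =>
    let m := F.modelChoice α S h
    open Classical in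
    if α < F.likelihood (S !m) (x :: h) / F.likelihood (S m) (x :: h) then !m else m

/-- The action of a switcher after a history: the policy of the adopted model, applied to the
posterior over its parameters. -/
def action (F : ParamFamily 𝓔 n) (α : ℝ) (S : Bool → EndowedModel A n) (h : List (A × Y)) : A :=
  (S (F.modelChoice α S h)).policy (F.posterior (S (F.modelChoice α S h)) h)

/-- The history of a switcher at the beginning of period `t` (most recent period first), given the
realization `y` of all potential outcomes. -/
def history (F : ParamFamily 𝓔 n) (α : ℝ) (S : Bool → EndowedModel A n) (y : A × ℕ → Y) :
    ℕ → List (A × Y)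
  | 0 => []
  | t + 1 =>
    let h := F.history α S y t
    (F.action α S h, y (F.action α S h, t)) :: h

/-- The initial model of `S` persists against the competing one: with positive probability, the
model choice converges to the initial model. -/
def Persists (F : ParamFamily 𝓔 n) (α : ℝ) (S : Bool → EndowedModel A n) : Prop :=
  0 < 𝓔.prob {y | ∃ T, ∀ t ≥ T,
    (S (F.modelChoice α S (F.history α S y t))).model = (S false).model}

/-- Constrained local robustness of `θ` within the family, for a myopic agent with switching
threshold `α`. -/
def IsConstrainedLocallyRobust (F : ParamFamily 𝓔 n) (α : ℝ) (θ : Finset (Param n)) : Prop :=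
  ∃ ε > 0, ∃ π : θ → ℝ, IsFullSupport θ π ∧ ∃ p : (θ → ℝ) → A, F.IsOptimalPolicy θ p ∧
    ∀ θc : Finset (Param n), F.IsModel θc →
      Metric.hausdorffDist (θ : Set (Param n)) (θc : Set (Param n)) ≤ ε →
    ∀ πc : θc → ℝ, IsFullSupport θc πc →
      levyProkhorovDist (beliefMeasure θ π) (beliefMeasure θc πc) ≤ ε →
    ∀ pc : (θc → ℝ) → A, F.IsOptimalPolicy θc pc →
      F.Persists α fun b => if b then ⟨θc, πc, pc⟩ else ⟨θ, π, p⟩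

end ParamFamily

end

open MeasureTheory

noncomputable section

open Filter Topology

/-! ### Empirical frequencies and their upper limits. -/

section Frequency

/-! The proof is by contraposition. If `θ` is not locally KL-minimizing at a Berk-Nash equilibrium
`σ`, some family parameter close to `θ` has strictly smaller `σ`-weighted divergence than all of
`θ`. This strict inequality is open in `σ` and the set of equilibria is compact
(`isCompact_isBerkNash`), so finitely many such parameters serve all equilibria. Adding them to `θ`
gives a nearby finite model, and a full-support prior near the given one exists on it
(`exists_fullSupport_near`).

Against this competitor `θ` almost surely fails to persist (`not_persists`). Suppose `θ` is used
forever from some period on. Average log-losses follow the divergences weighted by the empirical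
action frequencies (`ae_tendsto_logLoss`), and these frequencies have an equilibrium `σ` as a limit
point (`exists_isBerkNash_limit`). Along the corresponding periods the added parameter for `σ`
becomes infinitely more likely than every parameter of `θ`, whereas not switching bounds the Bayes
factor by `α`.

Two actions make the frequency one-dimensional. At an interior upper limit both actions recur while
the frequency is close to it (`exists_recurrent_freq`), so each action is optimal at some limit
belief on the same set of minimizers. A mixture of the two beliefs makes the agent indifferent. -/

open Classical in
/-- The relative frequency of `b` among the first `t` periods. -/
def freq (b : ℕ → Prop) (t : ℕ) : ℝ := (((Finset.range t).filter b).card : ℝ) / t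

lemma freq_nonneg (b : ℕ → Prop) (t : ℕ) : 0 ≤ freq b t := by unfold freq; positivity

lemma freq_le_one (b : ℕ → Prop) (t : ℕ) : freq b t ≤ 1 := by
  unfold freq
  classical
  refine div_le_one_of_le₀ ?_ (by positivity)
  exact_mod_cast (Finset.card_le_card (Finset.filter_subset _ _)).trans_eq (Finset.card_range t)

lemma freq_eq_sum (b : ℕ → Prop) [DecidablePred b] (t : ℕ) :
    freq b t = (∑ s ∈ Finset.range t, if b s then (1 : ℝ) else 0) / t := by
  unfold freq
  rw [Finset.card_filter]
  push_cast
  congr!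

lemma succ_mul_freq_succ (b : ℕ → Prop) [DecidablePred b] (t : ℕ) :
    ((t : ℝ) + 1) * freq b (t + 1) = t * freq b t + if b t then 1 else 0 := by
  rw [freq_eq_sum, freq_eq_sum, Finset.sum_range_succ]
  push_cast
  rcases Nat.eq_zero_or_pos t with rfl | ht
  · simp
  · have : (t : ℝ) ≠ 0 := by positivity
    have h2 : (t : ℝ) + 1 ≠ 0 := by positivity
    field_simp

lemma freq_succ_le (b : ℕ → Prop) (t : ℕ) : freq b (t + 1) ≤ freq b t + 1 / (t + 1) := by
  classical
  have h := succ_mul_freq_succ b t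
  have h0 := freq_nonneg b t
  have hp : (0 : ℝ) < t + 1 := by positivity
  rw [← mul_le_mul_iff_right₀ hp, h, mul_add, mul_one_div_cancel hp.ne']
  split_ifs <;> nlinarith

lemma freq_succ_le_of_not {b : ℕ → Prop} {t : ℕ} (hb : ¬ b t) : freq b (t + 1) ≤ freq b t := by
  classical
  have h := succ_mul_freq_succ b t
  have h0 := freq_nonneg b t
  have hp : (0 : ℝ) < t + 1 := by positivity
  rw [← mul_le_mul_iff_right₀ hp, h, if_neg hb]
  nlinarith

lemma freq_le_succ_of_mem {b : ℕ → Prop} {t : ℕ} (hb : b t) : freq b t ≤ freq b (t + 1) := by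
  classical
  have h := succ_mul_freq_succ b t
  have h0 := freq_le_one b t
  have hp : (0 : ℝ) < t + 1 := by positivity
  rw [← mul_le_mul_iff_right₀ hp, h, if_pos hb]
  nlinarith

lemma freq_not {b : ℕ → Prop} {t : ℕ} (ht : 0 < t) :
    freq (fun s => ¬ b s) t = 1 - freq b t := by
  classical
  have ht' : (t : ℝ) ≠ 0 := by positivity
  rw [freq_eq_sum, freq_eq_sum, eq_sub_iff_add_eq, ← add_div, ← Finset.sum_add_distrib,
    div_eq_one_iff_eq ht', Finset.sum_congr rfl (g := fun _ => (1 : ℝ))]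
  · simp
  · intro s _
    by_cases h : b s <;> simp [h]

lemma tendsto_freq_zero {b : ℕ → Prop} {T : ℕ} (hb : ∀ t ≥ T, ¬ b t) :
    Tendsto (freq b) atTop (𝓝 0) := by
  classical
  have h : ∀ t, freq b t ≤ (T : ℝ) / t := by
    intro t
    unfold freq
    gcongr
    calc ((Finset.range t).filter b).card ≤ (Finset.range T).card := by
          refine Finset.card_le_card fun s hs => ?_
          rw [Finset.mem_filter] at hs
          rw [Finset.mem_range]
          by_contra h
          exact hb s (not_lt.mp h) hs.2
      _ = T := Finset.card_range T
  exact squeeze_zero (freq_nonneg b) h (tendsto_const_div_atTop_nhds_zero_nat _)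

lemma tendsto_freq_one {b : ℕ → Prop} {T : ℕ} (hb : ∀ t ≥ T, b t) :
    Tendsto (freq b) atTop (𝓝 1) := by
  have h := (tendsto_freq_zero (b := fun t => ¬ b t) (T := T)
    fun t ht => not_not.mpr (hb t ht)).const_sub 1
  rw [sub_zero] at h
  refine h.congr' ?_
  filter_upwards [eventually_gt_atTop 0] with t ht
  rw [freq_not ht]
  ring

/-- Near the upper limit `x` of the relative frequency of `b`, the event `b` recurs unless `x = 0`,
and the complementary event recurs unless `x = 1`. -/
lemma exists_recurrent_freq (b : ℕ → Prop) : ∃ x : ℝ, 0 ≤ x ∧ x ≤ 1 ∧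
    (x ≠ 0 → ∀ η > 0, ∃ᶠ t in atTop, |freq b t - x| < η ∧ b t) ∧
    (x ≠ 1 → ∀ η > 0, ∃ᶠ t in atTop, |freq b t - x| < η ∧ ¬ b t) := by
  have bdd : IsBoundedUnder (· ≤ ·) atTop (freq b) := isBoundedUnder_of ⟨1, freq_le_one b⟩
  have bdd' : IsBoundedUnder (· ≥ ·) atTop (freq b) := isBoundedUnder_of ⟨0, freq_nonneg b⟩
  set x := limsup (freq b) atTop with hx
  have up : ∀ z, x < z → ∀ᶠ t in atTop, freq b t < z := fun z hz =>
    eventually_lt_of_limsup_lt (hx ▸ hz) bdd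
  have lo : ∀ z, z < x → ∃ᶠ t in atTop, z < freq b t := fun z hz =>
    frequently_lt_of_lt_limsup bdd'.isCoboundedUnder_le (hx ▸ hz)
  have x0 : 0 ≤ x := by
    by_contra h
    obtain ⟨t, ht⟩ := (up 0 (not_le.mp h)).exists
    exact absurd (freq_nonneg b t) (not_le.mpr ht)
  have x1 : x ≤ 1 := by
    by_contra h
    obtain ⟨t, ht⟩ := (lo 1 (not_le.mp h)).exists
    exact absurd (freq_le_one b t) (not_le.mpr ht)
  refine ⟨x, x0, x1, ?_, ?_⟩
  · intro hx0 η' hη'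
    have hxpos : 0 < x := lt_of_le_of_ne x0 (Ne.symm hx0)
    by_contra hcon
    rw [not_frequently] at hcon
    set η := min η' x with hη
    have hηpos : 0 < η := lt_min hη' hxpos
    have ev : ∀ᶠ t in atTop, x - η < freq b t → ¬ b t := by
      filter_upwards [hcon, up (x + η) (by linarith)] with t h1 h2 h3 h4
      refine h1 ⟨?_, h4⟩
      rw [abs_lt]
      constructor <;> linarith [min_le_left η' x]
    have inv : ∀ᶠ t : ℕ in atTop, (1 : ℝ) / (t + 1) ≤ η / 2 :=
      (tendsto_one_div_add_atTop_nhds_zero_nat (𝕜 := ℝ)).eventually_le_const (by positivity)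
    obtain ⟨T, hT⟩ := eventually_atTop.mp (ev.and inv)
    -- If the frequency stayed above `x - η`, then `b` would stop occurring and the frequency would
    -- tend to `0 < x`.
    have key : ∃ t ≥ T, freq b t ≤ x - η := by
      by_contra h
      push Not at h
      have := tendsto_freq_zero (T := T) fun t ht => (hT t ht).1 (h t ht)
      obtain ⟨t, ht, ht'⟩ := ((lo (x / 2) (by linarith)).and_eventually
        (this.eventually_lt_const (u := x / 2) (by linarith))).exists
      linarith
    obtain ⟨t₀, ht₀, hle⟩ := key
    -- Above `x - η` the frequency cannot rise, and from below one step adds at most `η / 2`; so it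
    -- stays away from its upper limit.
    have all : ∀ t ≥ t₀, freq b t ≤ x - η / 2 := by
      intro t ht
      induction t, ht using Nat.le_induction with
      | base => linarith
      | succ t ht ih =>
        by_cases h : x - η < freq b t
        · exact (freq_succ_le_of_not ((hT t (ht₀.trans ht)).1 h)).trans ih
        · have := freq_succ_le b t
          have := (hT t (ht₀.trans ht)).2
          linarith
    obtain ⟨t, ht, ht'⟩ := ((lo (x - η / 2) (by linarith)).and_eventually
      (eventually_ge_atTop t₀)).exists
    linarith [all t ht']
  · intro hx1 η hη
    have hxlt : x < 1 := lt_of_le_of_ne x1 hx1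
    by_contra hcon
    rw [not_frequently] at hcon
    have ev : ∀ᶠ t in atTop, x - η < freq b t → b t := by
      filter_upwards [hcon, up (x + η) (by linarith)] with t h1 h2 h3
      by_contra h4
      refine h1 ⟨?_, h4⟩
      rw [abs_lt]
      constructor <;> linarith
    obtain ⟨T, hT⟩ := eventually_atTop.mp ev
    obtain ⟨t₀, hlt, ht₀⟩ := ((lo (x - η) (by linarith)).and_eventually
      (eventually_ge_atTop T)).exists
    -- Above `x - η` the event occurs, so the frequency does not fall and never leaves this region;
    -- it would tend to `1 > x`.
    have all : ∀ t ≥ t₀, x - η < freq b t := by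
      intro t ht
      induction t, ht using Nat.le_induction with
      | base => exact hlt
      | succ t ht ih => exact ih.trans_le (freq_le_succ_of_mem (hT t (ht₀.trans ht) ih))
    have := tendsto_freq_one (T := t₀) fun t ht => hT t (ht₀.trans ht) (all t ht)
    obtain ⟨t, h1, h2⟩ := ((up ((x + 1) / 2) (by linarith)).and
      (this.eventually_const_lt (u := (x + 1) / 2) (by linarith))).exists
    linarith

end Frequency

/-! ### A strong law for orthogonal sequences. -/

section StrongLaw

variable {Ω : Type*} [MeasurableSpace Ω] {P : Measure Ω}

/-- Nonnegative random variables with summable expectations converge to zero almost surely. -/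
lemma ae_tendsto_zero_of_summable_integral {Z : ℕ → Ω → ℝ} (hZ : ∀ k, Integrable (Z k) P)
    (h0 : ∀ k ω, 0 ≤ Z k ω) {c : ℕ → ℝ} (hc : Summable c) (hle : ∀ k, ∫ ω, Z k ω ∂P ≤ c k) :
    ∀ᵐ ω ∂P, Tendsto (fun k => Z k ω) atTop (𝓝 0) := by
  have hsum : Summable fun k => ∫ ω, Z k ω ∂P :=
    hc.of_nonneg_of_le (fun k => integral_nonneg (h0 k)) hle
  have hfin : ∑' k, ∫⁻ ω, ENNReal.ofReal (Z k ω) ∂P ≠ ⊤ := by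
    simp_rw [← fun k => ofReal_integral_eq_lintegral_ofReal (hZ k) (ae_of_all _ (h0 k))]
    exact hsum.tsum_ofReal_ne_top
  rw [← lintegral_tsum fun k => (hZ k).aemeasurable.ennreal_ofReal] at hfin
  have := ae_lt_top' (AEMeasurable.tsum fun k => (hZ k).aemeasurable.ennreal_ofReal) hfin
  filter_upwards [this] with ω hω
  have ht := ENNReal.tendsto_atTop_zero_of_tsum_ne_top hω.ne
  have := (ENNReal.tendsto_toReal ENNReal.zero_ne_top).comp ht
  refine this.congr fun k => ?_
  simp [h0]

/-- The strong law of large numbers for orthogonal random variables that are bounded in `L²`. -/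
theorem strong_law_of_orthogonal {D : ℕ → Ω → ℝ} (hD : ∀ i, MemLp (D i) 2 P) {C : ℝ}
    (hC : ∀ i, ∫ ω, D i ω ^ 2 ∂P ≤ C) (horth : ∀ i j, i < j → ∫ ω, D i ω * D j ω ∂P = 0) :
    ∀ᵐ ω ∂P, Tendsto (fun n : ℕ => (∑ i ∈ Finset.range n, D i ω) / n) atTop (𝓝 0) := by
  have hint : ∀ i j, Integrable (fun ω => D i ω * D j ω) P := fun i j =>
    (hD i).integrable_mul (hD j)
  have hsq : ∀ i, Integrable (fun ω => D i ω ^ 2) P := fun i => (hD i).integrable_sq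
  have hC0 : 0 ≤ C := (integral_nonneg fun ω => sq_nonneg _).trans (hC 0)
  have horth' : ∀ i j, i ≠ j → ∫ ω, D i ω * D j ω ∂P = 0 := by
    intro i j hij
    rcases lt_or_gt_of_ne hij with h | h
    · exact horth i j h
    · simp_rw [mul_comm (D i _)]
      exact horth j i h
  have hS : ∀ n : ℕ, MemLp (fun ω => ∑ i ∈ Finset.range n, D i ω) 2 P := fun n =>
    memLp_finsetSum _ fun i _ => hD i
  have hS2 : ∀ n : ℕ, ∫ ω, (∑ i ∈ Finset.range n, D i ω) ^ 2 ∂P ≤ n * C := by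
    intro n
    simp_rw [sq, Finset.sum_mul_sum]
    rw [integral_finsetSum _ fun i _ => integrable_finsetSum _ fun j _ => hint i j]
    calc ∑ i ∈ Finset.range n, ∫ ω, ∑ j ∈ Finset.range n, D i ω * D j ω ∂P
        = ∑ i ∈ Finset.range n, ∫ ω, D i ω ^ 2 ∂P := by
          refine Finset.sum_congr rfl fun i hi => ?_
          rw [integral_finsetSum _ fun j _ => hint i j,
            Finset.sum_eq_single_of_mem i hi fun j _ hj => horth' i j hj.symm]
          simp_rw [sq]
      _ ≤ ∑ i ∈ Finset.range n, C := Finset.sum_le_sum fun i _ => hC i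
      _ = n * C := by simp
  -- `Z` handles the partial sums at squares, with mean at most `C / k ^ 2`; `W` bounds the
  -- fluctuation between consecutive squares.
  let Z : ℕ → Ω → ℝ := fun k ω => ((∑ i ∈ Finset.range (k ^ 2), D i ω) / (k : ℝ) ^ 2) ^ 2
  let W : ℕ → Ω → ℝ := fun k ω =>
    ((∑ i ∈ Finset.Ico (k ^ 2) ((k + 1) ^ 2), |D i ω|) / (k : ℝ) ^ 2) ^ 2
  -- The `9` comes from `(2 * k + 1) ^ 2 ≤ 9 * k ^ 2` for `k ≥ 1`, needed for `W`. At `k = 0`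
  -- division by zero makes everything vanish.
  have hsummable : Summable fun k : ℕ => 9 * C * (1 / (k : ℝ) ^ 2) :=
    (Real.summable_one_div_nat_pow.mpr one_lt_two).mul_left _
  have hZ : ∀ᵐ ω ∂P, Tendsto (fun k => Z k ω) atTop (𝓝 0) := by
    refine ae_tendsto_zero_of_summable_integral (fun k => ?_) (fun k ω => sq_nonneg _) hsummable
      fun k => ?_
    · simp only [Z, div_pow]
      exact (hS (k ^ 2)).integrable_sq.div_const _
    · simp only [Z, div_pow]
      rw [integral_div]
      rcases Nat.eq_zero_or_pos k with rfl | hk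
      · simp
      have hk' : (0 : ℝ) < k := by positivity
      have := hS2 (k ^ 2)
      rw [div_le_iff₀ (by positivity)]
      push_cast at this
      refine this.trans ?_
      have : 9 * C * (1 / (k : ℝ) ^ 2) * ((k : ℝ) ^ 2) ^ 2 = 9 * (k ^ 2 * C) := by
        field_simp
      rw [this]
      nlinarith [mul_nonneg (sq_nonneg (k : ℝ)) hC0]
  -- Cauchy-Schwarz on a block of `2 * k + 1` terms.
  have hWle : ∀ k ω, W k ω ≤
      (2 * k + 1) / ((k : ℝ) ^ 2) ^ 2 * ∑ i ∈ Finset.Ico (k ^ 2) ((k + 1) ^ 2), D i ω ^ 2 := by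
    intro k ω
    have h := sq_sum_le_card_mul_sum_sq (s := Finset.Ico (k ^ 2) ((k + 1) ^ 2))
      (f := fun i => |D i ω|)
    have hcard : ((Finset.Ico (k ^ 2) ((k + 1) ^ 2)).card : ℝ) = 2 * k + 1 := by
      rw [Nat.card_Ico, Nat.cast_sub (Nat.pow_le_pow_left (Nat.le_succ k) 2)]
      push_cast
      ring
    rw [hcard] at h
    simp only [sq_abs] at h
    simp only [W, div_pow]
    rw [div_mul_eq_mul_div]
    gcongr
  have hWmem : ∀ k, MemLp (fun ω => ∑ i ∈ Finset.Ico (k ^ 2) ((k + 1) ^ 2), |D i ω|) 2 P :=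
    fun k => memLp_finsetSum _ fun i _ => (hD i).abs
  have hW : ∀ᵐ ω ∂P, Tendsto (fun k => W k ω) atTop (𝓝 0) := by
    have hWint : ∀ k, Integrable (W k) P := by
      intro k
      simp only [W, div_pow]
      exact (hWmem k).integrable_sq.div_const _
    refine ae_tendsto_zero_of_summable_integral hWint (fun k ω => sq_nonneg _) hsummable
      fun k => ?_
    have hi : Integrable (fun ω => (2 * (k : ℝ) + 1) / ((k : ℝ) ^ 2) ^ 2 *
        ∑ i ∈ Finset.Ico (k ^ 2) ((k + 1) ^ 2), D i ω ^ 2) P :=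
      (integrable_finsetSum _ fun i _ => hsq i).const_mul _
    refine (integral_mono (hWint k) hi (hWle k)).trans ?_
    rw [integral_const_mul, integral_finsetSum _ fun i _ => hsq i]
    have hb : ∑ i ∈ Finset.Ico (k ^ 2) ((k + 1) ^ 2), ∫ ω, D i ω ^ 2 ∂P ≤ (2 * k + 1) * C := by
      refine (Finset.sum_le_sum fun i _ => hC i).trans ?_
      rw [Finset.sum_const, Nat.card_Ico, nsmul_eq_mul,
        Nat.cast_sub (Nat.pow_le_pow_left (Nat.le_succ k) 2)]
      push_cast
      refine le_of_eq ?_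
      ring
    refine (mul_le_mul_of_nonneg_left hb (by positivity)).trans ?_
    rcases Nat.eq_zero_or_pos k with rfl | hk
    · simp
    have hk' : (1 : ℝ) ≤ k := by exact_mod_cast hk
    rw [div_mul_eq_mul_div, div_le_iff₀ (by positivity)]
    have : 9 * C * (1 / (k : ℝ) ^ 2) * ((k : ℝ) ^ 2) ^ 2 = (9 * k ^ 2) * C := by
      field_simp
    rw [this, ← mul_assoc]
    refine mul_le_mul_of_nonneg_right ?_ hC0
    nlinarith
  filter_upwards [hZ, hW] with ω h1 h2
  have hroot : ∀ {f : ℕ → ℝ}, Tendsto (fun k => f k ^ 2) atTop (𝓝 0) →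
      Tendsto (fun k => |f k|) atTop (𝓝 0) := by
    intro f hf
    have := hf.sqrt
    simpa [Real.sqrt_sq_eq_abs] using this
  have hsum := (hroot h1).add (hroot h2)
  rw [add_zero] at hsum
  have hsqrt : Tendsto Nat.sqrt atTop atTop := by
    refine tendsto_atTop_atTop.mpr fun b => ⟨b ^ 2, fun a ha => ?_⟩
    rw [Nat.le_sqrt']
    exact ha
  have hcomp := hsum.comp hsqrt
  refine squeeze_zero_norm' ?_ hcomp
  filter_upwards [eventually_gt_atTop 0] with n hn
  set k := Nat.sqrt n with hk
  have hkn : k ^ 2 ≤ n := Nat.sqrt_le' n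
  have hnk : n < (k + 1) ^ 2 := Nat.lt_succ_sqrt' n
  have hkpos : 0 < k := Nat.sqrt_pos.mpr hn
  have hk0 : (0 : ℝ) < (k : ℝ) ^ 2 := by positivity
  have hdecomp : ∑ i ∈ Finset.range n, D i ω =
      ∑ i ∈ Finset.range (k ^ 2), D i ω + ∑ i ∈ Finset.Ico (k ^ 2) n, D i ω :=
    (Finset.sum_range_add_sum_Ico _ hkn).symm
  have hrest : |∑ i ∈ Finset.Ico (k ^ 2) n, D i ω| ≤
      ∑ i ∈ Finset.Ico (k ^ 2) ((k + 1) ^ 2), |D i ω| :=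
    (Finset.abs_sum_le_sum_abs _ _).trans
      (Finset.sum_le_sum_of_subset_of_nonneg (Finset.Ico_subset_Ico_right hnk.le)
        fun _ _ _ => abs_nonneg _)
  have hkn' : (k : ℝ) ^ 2 ≤ n := by exact_mod_cast hkn
  rw [Real.norm_eq_abs, abs_div, Nat.abs_cast]
  simp only [Function.comp_apply, ← hk]
  rw [abs_div, abs_div, abs_of_pos hk0, ← add_div]
  refine div_le_div₀ (by positivity) ?_ hk0 hkn'
  rw [hdecomp]
  refine (abs_add_le _ _).trans ?_
  exact add_le_add_right (hrest.trans (le_abs_self _)) _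

end StrongLaw

/-! ### Measurability of finite selections. -/

section FiniteChoice

variable {Ω ι β : Type*} [MeasurableSpace Ω] [MeasurableSpace β] [Finite ι]

/-- Split according to the value of `c`. Measurability of `c` is expressed by level sets because the
actions carry no σ-algebra. -/
lemma measurableSet_setOf_choice {c : Ω → ι} (hc : ∀ i, MeasurableSet {x | c x = i})
    {p : ι → Ω → Prop} (hp : ∀ i, MeasurableSet {x | p i x}) :
    MeasurableSet {x | p (c x) x} := by
  have : {x | p (c x) x} = ⋃ i, {x | c x = i} ∩ {x | p i x} := by
    ext x
    simp
  rw [this]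
  exact MeasurableSet.iUnion fun i => (hc i).inter (hp i)

lemma measurable_choice {c : Ω → ι} (hc : ∀ i, MeasurableSet {x | c x = i})
    {g : ι → Ω → β} (hg : ∀ i, Measurable (g i)) : Measurable fun x => g (c x) x :=
  fun s hs => measurableSet_setOf_choice (p := fun i x => g i x ∈ s) hc fun i => hg i hs

end FiniteChoice

/-! ### Independence of an outcome from the past. -/

section Independence

open ProbabilityTheory

/-- `f` factors through the coordinates in `s`, with arbitrary values filled in elsewhere, and
disjoint blocks of coordinates are independent. -/
lemma indepFun_eval_of_dependsOn {ι Y : Type*} [MeasurableSpace Y] {μ : ι → Measure Y}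
    [∀ i, IsProbabilityMeasure (μ i)] {f : (ι → Y) → ℝ} (hf : Measurable f) {s : Finset ι}
    (hs : DependsOn f s) {i : ι} (hi : i ∉ s) :
    IndepFun f (fun y => y i) (Measure.infinitePi μ) := by
  classical
  have hne : ∀ j, Nonempty Y := fun j => nonempty_of_isProbabilityMeasure (μ j)
  let y₀ : ι → Y := fun j => (hne j).some
  let ext : (s → Y) → ι → Y := fun z j => if h : j ∈ s then z ⟨j, h⟩ else y₀ j
  have hext : Measurable ext := by
    refine measurable_pi_lambda _ fun j => ?_
    by_cases h : j ∈ s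
    · simp only [ext, h, dite_true]
      exact measurable_pi_apply _
    · simp only [ext, h, dite_false]
      exact measurable_const
  have hind := (iIndepFun_infinitePi (P := μ) (X := fun _ y => y)
    fun _ => measurable_id).indepFun_finset s {i} (Finset.disjoint_singleton_right.mpr hi)
    fun j => measurable_pi_apply j
  have hcomp := hind.comp (hf.comp hext)
    (measurable_pi_apply (⟨i, Finset.mem_singleton_self i⟩ : ({i} : Finset ι)))
  have hfac : f = (f ∘ ext) ∘ fun y (j : s) => y j := by
    ext y
    refine hs fun j hj => ?_
    have hj' : j ∈ s := hj
    simp [ext, hj']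
  rw [hfac]
  exact hcomp

end Independence

namespace Environment

variable {A Y : Type*} [MeasurableSpace Y]

instance (𝓔 : Environment A Y) : IsProbabilityMeasure 𝓔.prob := by
  unfold prob
  infer_instance

lemma measurePreserving_eval (𝓔 : Environment A Y) (i : A × ℕ) :
    MeasurePreserving (fun y : A × ℕ → Y => y i) 𝓔.prob (𝓔.law i.1) :=
  measurePreserving_eval_infinitePi (fun i : A × ℕ => 𝓔.law i.1) i

/-- Outcomes of period `t` are independent of functions of the outcomes of earlier periods. -/
lemma integral_mul_eval [Fintype A] (𝓔 : Environment A Y) {f : (A × ℕ → Y) → ℝ}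
    (hf : Measurable f) {t : ℕ} (hdep : DependsOn f {i | i.2 < t}) (a : A) {g : Y → ℝ}
    (hg : Measurable g) :
    ∫ y, f y * g (y (a, t)) ∂𝓔.prob = (∫ y, f y ∂𝓔.prob) * ∫ z, g z ∂𝓔.law a := by
  have hdep' : DependsOn f ((Finset.univ ×ˢ Finset.range t : Finset (A × ℕ)) : Set (A × ℕ)) :=
    hdep.mono fun i hi => by simpa using hi
  have hind := indepFun_eval_of_dependsOn (μ := fun i : A × ℕ => 𝓔.law i.1) hf hdep'
    (i := (a, t)) (by simp)
  have h := (hind.comp measurable_id hg).integral_fun_mul_eq_mul_integral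
    hf.aestronglyMeasurable (hg.comp (measurable_pi_apply _)).aestronglyMeasurable
  have hmp := 𝓔.measurePreserving_eval (a, t)
  have hint : ∫ y, g (y (a, t)) ∂𝓔.prob = ∫ z, g z ∂𝓔.law a := by
    rw [← hmp.map_eq, integral_map hmp.measurable.aemeasurable hg.aestronglyMeasurable]
  rw [← hint]
  exact h

end Environment

/-! ### Likelihoods and log-losses. -/

namespace ParamFamily

variable {A Y : Type*} [MeasurableSpace Y] {𝓔 : Environment A Y} {n : ℕ}

/-- Likelihood of a history given the parameter `ω`. -/
def paramLikelihood (F : ParamFamily 𝓔 n) (ω : Param n) (h : List (A × Y)) : ℝ :=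
  (h.map fun x => F.q x.1 ω x.2).prod

/-- Log-likelihood ratio of the truth against the parameter `ω` along a history. -/
def logLoss (F : ParamFamily 𝓔 n) (ω : Param n) (h : List (A × Y)) : ℝ :=
  (h.map fun x => Real.log (𝓔.qstar x.1 x.2 / F.q x.1 ω x.2)).sum

/-- The true likelihood is a factor common to all parameters, so likelihood ratios are exponentials
of differences of log-losses. -/
lemma paramLikelihood_eq (F : ParamFamily 𝓔 n) {ω : Param n} (hω : ω ∈ F.params)
    (h : List (A × Y)) :
    F.paramLikelihood ω h =
      (h.map fun x => 𝓔.qstar x.1 x.2).prod * Real.exp (-F.logLoss ω h) := by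
  induction h with
  | nil => simp [paramLikelihood, logLoss]
  | cons x h ih =>
    simp only [paramLikelihood, logLoss, List.map_cons, List.prod_cons, List.sum_cons] at ih ⊢
    have h1 := 𝓔.qstar_pos x.1 x.2
    have h2 := F.q_pos x.1 ω hω x.2
    rw [ih, neg_add, Real.exp_add, Real.exp_neg (Real.log _), Real.exp_log (div_pos h1 h2)]
    field_simp

lemma prod_qstar_pos (h : List (A × Y)) : 0 < (h.map fun x => 𝓔.qstar x.1 x.2).prod :=
  List.prod_pos fun _ hx => by
    obtain ⟨x, -, rfl⟩ := List.mem_map.mp hx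
    exact 𝓔.qstar_pos _ _

lemma paramLikelihood_pos (F : ParamFamily 𝓔 n) {ω : Param n} (hω : ω ∈ F.params)
    (h : List (A × Y)) : 0 < F.paramLikelihood ω h := by
  rw [F.paramLikelihood_eq hω]
  exact mul_pos (prod_qstar_pos h) (Real.exp_pos _)

lemma measurable_logRatio (F : ParamFamily 𝓔 n) (a : A) {ω : Param n} (hω : ω ∈ F.params) :
    Measurable fun y => Real.log (𝓔.qstar a y / F.q a ω y) :=
  ((𝓔.measurable_qstar a).div (F.measurable_q a ω hω)).log

lemma memLp_logRatio (F : ParamFamily 𝓔 n) (a : A) {ω : Param n} (hω : ω ∈ F.params) :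
    MemLp (fun y => Real.log (𝓔.qstar a y / F.q a ω y)) 2 (𝓔.law a) := by
  obtain ⟨g, hg, hle⟩ := F.log_ratio_bound a ω hω
  exact hg.mono' (F.measurable_logRatio a hω).aestronglyMeasurable hle

lemma kl_eq_integral_law (F : ParamFamily 𝓔 n) (a : A) (ω : Param n) :
    F.kl a ω = ∫ y, Real.log (𝓔.qstar a y / F.q a ω y) ∂𝓔.law a := by
  unfold kl Environment.law
  rw [integral_withDensity_eq_integral_toReal_smul (𝓔.measurable_qstar a).ennreal_ofReal
    (ae_of_all _ fun _ => ENNReal.ofReal_lt_top)]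
  simp [ENNReal.toReal_ofReal (𝓔.qstar_pos a _).le]

lemma integral_log_div_eq (F : ParamFamily 𝓔 n) (a : A) {ω ω' : Param n} (hω : ω ∈ F.params)
    (hω' : ω' ∈ F.params) :
    ∫ y, Real.log (F.q a ω' y / F.q a ω y) ∂𝓔.law a = F.kl a ω - F.kl a ω' := by
  rw [kl_eq_integral_law, kl_eq_integral_law, ← integral_sub
    ((F.memLp_logRatio a hω).integrable one_le_two) ((F.memLp_logRatio a hω').integrable one_le_two)]
  congr 1
  ext y
  have h0 := (𝓔.qstar_pos a y).ne'
  have h1 := (F.q_pos a ω hω y).ne'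
  have h2 := (F.q_pos a ω' hω' y).ne'
  rw [Real.log_div h2 h1, Real.log_div h0 h1, Real.log_div h0 h2]
  ring

/-! ### The law of large numbers under adaptive actions. -/

section Switcher

variable (F : ParamFamily 𝓔 n) (α : ℝ) (S : Bool → EndowedModel A n)

/-- The action of a switcher in period `t`. -/
def act (y : A × ℕ → Y) (t : ℕ) : A := F.action α S (F.history α S y t)

lemma history_succ (y : A × ℕ → Y) (t : ℕ) :
    F.history α S y (t + 1) =
      (F.act α S y t, y (F.act α S y t, t)) :: F.history α S y t := rfl

/-- This is predictability: the action of period `t` will be independent of the potential outcomes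
of period `t`. -/
lemma history_congr {y y' : A × ℕ → Y} {t : ℕ} (h : ∀ i : A × ℕ, i.2 < t → y i = y' i) :
    F.history α S y t = F.history α S y' t := by
  induction t with
  | zero => rfl
  | succ t ih =>
    have ih' := ih fun i hi => h i (hi.trans (Nat.lt_succ_self t))
    rw [history_succ, history_succ, act, act, ih']
    rw [h _ (Nat.lt_succ_self t)]

lemma act_congr {y y' : A × ℕ → Y} {t : ℕ} (h : ∀ i : A × ℕ, i.2 < t → y i = y' i) :
    F.act α S y t = F.act α S y' t := by
  rw [act, act, F.history_congr α S h]

lemma logLoss_history (ω : Param n) (y : A × ℕ → Y) (t : ℕ) :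
    F.logLoss ω (F.history α S y t) = ∑ s ∈ Finset.range t,
      Real.log (𝓔.qstar (F.act α S y s) (y (F.act α S y s, s)) /
        F.q (F.act α S y s) ω (y (F.act α S y s, s))) := by
  induction t with
  | zero => rfl
  | succ t ih =>
    rw [Finset.sum_range_succ, ← ih, history_succ, logLoss, List.map_cons, List.sum_cons, add_comm]
    rfl

variable [Fintype A] (hS : ∀ m, F.IsModel (S m).model)
  (hp : ∀ m, F.IsOptimalPolicy (S m).model (S m).policy)

include hS hp in
-- The claims need a joint induction: the action depends on the adopted model and its posterior, and
-- their next values depend on the action.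
lemma measurable_history_aux (t : ℕ) :
    (∀ ω ∈ F.params, Measurable fun y => F.paramLikelihood ω (F.history α S y t)) ∧
    (∀ m, Measurable fun y => F.posterior (S m) (F.history α S y t)) ∧
    (∀ m, MeasurableSet {y | F.modelChoice α S (F.history α S y t) = m}) ∧
    ∀ a, MeasurableSet {y | F.act α S y t = a} := by
  have hact : ∀ t, (∀ m, Measurable fun y => F.posterior (S m) (F.history α S y t)) →
      (∀ m, MeasurableSet {y | F.modelChoice α S (F.history α S y t) = m}) →
      ∀ a, MeasurableSet {y | F.act α S y t = a} := by
    intro t h1 h2 a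
    exact measurableSet_setOf_choice h2
      (p := fun m y => (S m).policy (F.posterior (S m) (F.history α S y t)) = a)
      fun m => h1 m ((hp m).1 a)
  induction t with
  | zero =>
    have h1 : ∀ m, Measurable fun y => F.posterior (S m) (F.history α S y 0) :=
      fun m => measurable_const
    have h2 : ∀ m, MeasurableSet {y | F.modelChoice α S (F.history α S y 0) = m} :=
      fun m => MeasurableSet.const (false = m)
    exact ⟨fun ω _ => measurable_const, h1, h2, hact 0 h1 h2⟩
  | succ t ih =>
    obtain ⟨hl, hpost, hm, ha⟩ := ih
    have hq : ∀ ω ∈ F.params, Measurable fun y : A × ℕ → Y =>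
        F.q (F.act α S y t) ω (y (F.act α S y t, t)) := fun ω hω =>
      measurable_choice ha (g := fun a y => F.q a ω (y (a, t)))
        fun a => (F.measurable_q a ω hω).comp (measurable_pi_apply _)
    have hl' : ∀ ω ∈ F.params,
        Measurable fun y => F.paramLikelihood ω (F.history α S y (t + 1)) := by
      intro ω hω
      simp only [history_succ, paramLikelihood, List.map_cons, List.prod_cons]
      exact (hq ω hω).mul (hl ω hω)
    have hpost' : ∀ m, Measurable fun y => F.posterior (S m) (F.history α S y (t + 1)) := by
      intro m
      have hmeas : ∀ ω : (S m).model, Measurable fun y =>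
          F.posterior (S m) (F.history α S y t) ω *
            F.q (F.act α S y t) ω (y (F.act α S y t, t)) := fun ω =>
        ((measurable_pi_apply ω).comp (hpost m)).mul (hq ω ((hS m).2 ω.2))
      refine measurable_pi_lambda _ fun ω => ?_
      exact (hmeas ω).div (Finset.measurable_sum _ fun ω' _ => hmeas ω')
    have hlik : ∀ m, Measurable fun y => F.likelihood (S m) (F.history α S y (t + 1)) :=
      fun m => Finset.measurable_sum _ fun ω _ => (hl' ω ((hS m).2 ω.2)).const_mul _
    have hm' : ∀ m, MeasurableSet {y | F.modelChoice α S (F.history α S y (t + 1)) = m} := by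
      classical
      intro m'
      refine measurableSet_setOf_choice hm (p := fun m y =>
        (if α < F.likelihood (S !m) (F.history α S y (t + 1)) /
          F.likelihood (S m) (F.history α S y (t + 1)) then !m else m) = m') fun m => ?_
      have : Measurable fun y => if α < F.likelihood (S !m) (F.history α S y (t + 1)) /
          F.likelihood (S m) (F.history α S y (t + 1)) then !m else m :=
        Measurable.ite (measurableSet_lt measurable_const ((hlik _).div (hlik _)))
          measurable_const measurable_const
      exact this (measurableSet_singleton m')
    exact ⟨hl', hpost', hm', hact _ hpost' hm'⟩

include hS hp in
lemma measurableSet_act_eq (t : ℕ) (a : A) : MeasurableSet {y | F.act α S y t = a} :=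
  (F.measurable_history_aux α S hS hp t).2.2.2 a

include hS hp in
/-- The law of large numbers along the periods in which the switcher takes action `a`. -/
lemma ae_tendsto_sum_act_eq [DecidableEq A] (a : A) {X : Y → ℝ} (hX : Measurable X)
    (hX2 : MemLp X 2 (𝓔.law a)) (hX0 : ∫ z, X z ∂𝓔.law a = 0) :
    ∀ᵐ y ∂𝓔.prob, Tendsto (fun t : ℕ =>
      (∑ s ∈ Finset.range t, if F.act α S y s = a then X (y (a, s)) else 0) / t)
      atTop (𝓝 0) := by
  let E : ℕ → Set (A × ℕ → Y) := fun t => {y | F.act α S y t = a}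
  have hE : ∀ t, MeasurableSet (E t) := fun t => F.measurableSet_act_eq α S hS hp t a
  let D : ℕ → (A × ℕ → Y) → ℝ := fun t => (E t).indicator fun y => X (y (a, t))
  have hXm : ∀ t, Measurable fun y : A × ℕ → Y => X (y (a, t)) := fun t =>
    hX.comp (measurable_pi_apply _)
  have hXL : ∀ t, MemLp (fun y : A × ℕ → Y => X (y (a, t))) 2 𝓔.prob := fun t =>
    hX2.comp_measurePreserving (𝓔.measurePreserving_eval (a, t))
  have hD : ∀ t, MemLp (D t) 2 𝓔.prob := fun t => (hXL t).indicator (hE t)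
  have hsq : ∀ t, ∫ y, D t y ^ 2 ∂𝓔.prob ≤ ∫ z, X z ^ 2 ∂𝓔.law a := by
    intro t
    have hmp := 𝓔.measurePreserving_eval (a, t)
    have : ∫ z, X z ^ 2 ∂𝓔.law a = ∫ y, X (y (a, t)) ^ 2 ∂𝓔.prob := by
      rw [← hmp.map_eq, integral_map hmp.measurable.aemeasurable
        (hX.pow_const 2).aestronglyMeasurable]
    rw [this]
    refine integral_mono (hD t).integrable_sq (hXL t).integrable_sq fun y => ?_
    by_cases h : y ∈ E t
    · simp [D, h]
    · simp only [D, Set.indicator_of_notMem h, zero_pow two_ne_zero]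
      exact sq_nonneg _
  -- For `s < t`, both `D s` and the event `E t` are determined before period `t`, while the
  -- remaining factor `X (y (a, t))` is independent of them and has mean zero.
  have horth : ∀ s t, s < t → ∫ y, D s y * D t y ∂𝓔.prob = 0 := by
    intro s t hst
    let f : (A × ℕ → Y) → ℝ := (E t).indicator (D s)
    have hf : Measurable f := ((hXm s).indicator (hE s)).indicator (hE t)
    have hdep : DependsOn f {i | i.2 < t} := by
      intro y y' hyy
      have h1 : F.act α S y t = F.act α S y' t := F.act_congr α S hyy
      have h2 : F.act α S y s = F.act α S y' s :=
        F.act_congr α S fun i hi => hyy i (hi.trans hst)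
      have h3 : y (a, s) = y' (a, s) := hyy (a, s) hst
      simp only [f, D, E, Set.indicator, Set.mem_ofPred_eq, h1, h2, h3]
    have h := 𝓔.integral_mul_eval hf hdep a hX
    rw [hX0, mul_zero] at h
    rw [← h]
    congr 1
    ext y
    by_cases hy : y ∈ E t
    · simp [f, D, hy]
    · simp [f, D, hy]
  filter_upwards [strong_law_of_orthogonal hD hsq horth] with y hy
  refine hy.congr fun t => ?_
  congr 1
  exact Finset.sum_congr rfl fun s _ => by simp [D, E, Set.indicator_apply]

include hS hp in
/-- The average log-likelihood ratio of the truth against `ω` is asymptotically the divergence of `ω`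
weighted by the empirical frequencies of the actions. -/
lemma ae_tendsto_logLoss {ω : Param n} (hω : ω ∈ F.params) :
    ∀ᵐ y ∂𝓔.prob, Tendsto (fun t : ℕ => F.logLoss ω (F.history α S y t) / t -
      ∑ a, freq (fun s => F.act α S y s = a) t * F.kl a ω) atTop (𝓝 0) := by
  classical
  have hmean : ∀ a, ∫ z, (Real.log (𝓔.qstar a z / F.q a ω z) - F.kl a ω) ∂𝓔.law a = 0 := by
    intro a
    rw [integral_sub ((F.memLp_logRatio a hω).integrable one_le_two) (integrable_const _),
      ← kl_eq_integral_law]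
    simp
  have hall := ae_all_iff.mpr fun a => F.ae_tendsto_sum_act_eq α S hS hp a
    ((F.measurable_logRatio a hω).sub_const (F.kl a ω))
    ((F.memLp_logRatio a hω).sub (memLp_const _)) (hmean a)
  filter_upwards [hall] with y hy
  have h := tendsto_finsetSum Finset.univ fun a _ => hy a
  rw [Finset.sum_const_zero] at h
  refine h.congr fun t => ?_
  rw [logLoss_history, ← Finset.sum_div]
  simp_rw [freq_eq_sum, div_mul_eq_mul_div]
  rw [← Finset.sum_div, ← sub_div, Finset.sum_comm]
  congr 1
  simp_rw [Finset.sum_mul]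
  rw [Finset.sum_comm (s := Finset.univ), ← Finset.sum_sub_distrib]
  refine Finset.sum_congr rfl fun s _ => ?_
  simp

end Switcher

end ParamFamily

/-- Choose a subsequence with errors below `1 / (n + 1)`; its image filter lets limits along `atTop`
be restricted without reindexing. -/
lemma exists_filter_of_frequently {x : ℝ} {g : ℕ → ℝ} {c : ℕ → Prop}
    (h : ∀ η > 0, ∃ᶠ t in atTop, |g t - x| < η ∧ c t) :
    ∃ f : Filter ℕ, f.NeBot ∧ f ≤ atTop ∧ Tendsto g f (𝓝 x) ∧ ∀ᶠ t in f, c t := by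
  obtain ⟨φ, hφ, hp⟩ := extraction_forall_of_frequently
    (P := fun n t => |g t - x| < 1 / ((n : ℝ) + 1) ∧ c t) fun n => h _ (by positivity)
  refine ⟨map φ atTop, inferInstance, hφ.tendsto_atTop, ?_, eventually_map.mpr (Eventually.of_forall fun n => (hp n).2)⟩
  rw [tendsto_map'_iff, tendsto_iff_norm_sub_tendsto_zero]
  exact squeeze_zero (fun _ => norm_nonneg _) (fun n => (hp n).1.le)
    tendsto_one_div_add_atTop_nhds_zero_nat

namespace ParamFamily

variable {A Y : Type*} [MeasurableSpace Y] {𝓔 : Environment A Y} {n : ℕ}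

/-! ### Closed form and bounds for posteriors. -/

section Posterior

variable (F : ParamFamily 𝓔 n) {M : EndowedModel A n} (hM : F.IsModel M.model)
  (hprior : IsFullSupport M.model M.prior)

include hM hprior

lemma likelihood_pos (h : List (A × Y)) : 0 < F.likelihood M h := by
  have : Nonempty M.model := hM.1.to_subtype
  exact Finset.sum_pos (fun ω _ => mul_pos (hprior.2 ω) (F.paramLikelihood_pos (hM.2 ω.2) h))
    Finset.univ_nonempty

/-- The normalizing constants of Bayes' rule are ratios of successive model likelihoods and
telescope. -/
lemma posterior_eq (h : List (A × Y)) (ω : M.model) :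
    F.posterior M h ω = M.prior ω * F.paramLikelihood ω h / F.likelihood M h := by
  induction h generalizing ω with
  | nil =>
    have h1 : F.likelihood M [] = 1 := by
      rw [← hprior.1.2]
      exact Finset.sum_congr rfl fun ω' _ => mul_one _
    rw [h1, div_one]
    exact (mul_one _).symm
  | cons x h ih =>
    have hl := (F.likelihood_pos hM hprior h).ne'
    have hsum : ∑ ω' : M.model, F.posterior M h ω' * F.q x.1 ω' x.2 =
        F.likelihood M (x :: h) / F.likelihood M h := by
      rw [eq_div_iff hl, Finset.sum_mul]
      refine Finset.sum_congr rfl fun ω' _ => ?_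
      rw [ih, List.map_cons, List.prod_cons, paramLikelihood]
      field_simp
    simp only [posterior, bayes]
    rw [hsum, ih, div_div_eq_mul_div]
    congr 1
    simp only [paramLikelihood, List.map_cons, List.prod_cons]
    field_simp

lemma posterior_mem_stdSimplex (h : List (A × Y)) : F.posterior M h ∈ stdSimplex ℝ M.model := by
  have hl := F.likelihood_pos hM hprior h
  refine ⟨fun ω => ?_, ?_⟩
  · rw [F.posterior_eq hM hprior]
    exact div_nonneg (mul_nonneg (hprior.2 ω).le (F.paramLikelihood_pos (hM.2 ω.2) h).le) hl.le
  · simp_rw [F.posterior_eq hM hprior]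
    rw [← Finset.sum_div]
    exact div_self hl.ne'

/-- Keep only the term of `ω'` in the normalizing sum. A vanishing likelihood ratio then forces a
vanishing posterior. -/
lemma posterior_le (h : List (A × Y)) (ω ω' : M.model) :
    F.posterior M h ω ≤ M.prior ω / M.prior ω' *
      (F.paramLikelihood ω h / F.paramLikelihood ω' h) := by
  have h' := F.paramLikelihood_pos (hM.2 ω'.2) h
  have hle : M.prior ω' * F.paramLikelihood ω' h ≤ F.likelihood M h :=
    Finset.single_le_sum (f := fun ω : M.model => M.prior ω * F.paramLikelihood ω h)
      (fun ω _ => mul_nonneg (hprior.2 ω).le (F.paramLikelihood_pos (hM.2 ω.2) h).le)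
      (Finset.mem_univ ω')
  rw [F.posterior_eq hM hprior, div_mul_div_comm]
  exact div_le_div_of_nonneg_left
    (mul_nonneg (hprior.2 ω).le (F.paramLikelihood_pos (hM.2 ω.2) h).le)
    (mul_pos (hprior.2 ω') h') hle

end Posterior

lemma continuous_payoff (F : ParamFamily 𝓔 n) (θ : Finset (Param n)) (a : A) :
    Continuous fun π => F.payoff θ π a := by
  unfold payoff
  fun_prop

lemma payoff_add_smul (F : ParamFamily 𝓔 n) (θ : Finset (Param n)) (v w : ℝ) (π π' : θ → ℝ)
    (a : A) :
    F.payoff θ (v • π + w • π') a = v * F.payoff θ π a + w * F.payoff θ π' a := by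
  simp only [payoff, Pi.add_apply, Pi.smul_apply, smul_eq_mul, Finset.mul_sum]
  rw [← Finset.sum_add_distrib]
  exact Finset.sum_congr rfl fun _ _ => by ring

lemma isClosed_myopicOpt (F : ParamFamily 𝓔 n) (θ : Finset (Param n)) (a : A) :
    IsClosed {π | a ∈ F.myopicOpt θ π} := by
  have : {π | a ∈ F.myopicOpt θ π} = ⋂ b, {π | F.payoff θ π b ≤ F.payoff θ π a} := by
    ext π
    simp [myopicOpt]
  rw [this]
  exact isClosed_iInter fun b =>
    isClosed_le (F.continuous_payoff θ b) (F.continuous_payoff θ a)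

/-! ### Limit beliefs and equilibrium limit points. -/

section Limits

variable [Fintype A] (F : ParamFamily 𝓔 n)

/-- Divergence of `ω`, weighted by the mixed action `σ`. -/
def wkl (σ : A → ℝ) (ω : Param n) : ℝ := ∑ a, σ a * F.kl a ω

lemma continuous_wkl (ω : Param n) : Continuous fun σ => F.wkl σ ω := by
  unfold wkl
  fun_prop

/-- Along histories whose average log-likelihood ratios approach the divergences weighted by `σ`,
parameters with larger divergence become infinitely less likely. -/
lemma tendsto_paramLikelihood_div {h : ℕ → List (A × Y)} {σ : ℕ → A → ℝ} {σ' : A → ℝ}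
    {ω ω' : Param n} (hω : ω ∈ F.params) (hω' : ω' ∈ F.params)
    (hl : Tendsto (fun t : ℕ => F.logLoss ω (h t) / t - F.wkl (σ t) ω) atTop (𝓝 0))
    (hl' : Tendsto (fun t : ℕ => F.logLoss ω' (h t) / t - F.wkl (σ t) ω') atTop (𝓝 0))
    {f : Filter ℕ} (hf : f ≤ atTop) (hσ : Tendsto σ f (𝓝 σ')) (hlt : F.wkl σ' ω' < F.wkl σ' ω) :
    Tendsto (fun t => F.paramLikelihood ω (h t) / F.paramLikelihood ω' (h t)) f (𝓝 0) := by
  have h1 := (hl.mono_left hf).add (((F.continuous_wkl ω).tendsto σ').comp hσ)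
  have h2 := (hl'.mono_left hf).add (((F.continuous_wkl ω').tendsto σ').comp hσ)
  have h3 := h2.sub h1
  have hcast : Tendsto (fun t : ℕ => (t : ℝ)) f atTop := tendsto_natCast_atTop_atTop.mono_left hf
  have hneg : 0 + F.wkl σ' ω' - (0 + F.wkl σ' ω) < 0 := by linarith
  -- The log of the likelihood ratio is `t` times a quantity with negative limit.
  have h4 := Real.tendsto_exp_atBot.comp (hcast.atTop_mul_neg hneg h3)
  refine h4.congr' ?_
  filter_upwards [hf (eventually_gt_atTop 0)] with t ht
  have ht' : (t : ℝ) ≠ 0 := by positivity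
  have hq := (prod_qstar_pos (𝓔 := 𝓔) (h t)).ne'
  rw [F.paramLikelihood_eq hω, F.paramLikelihood_eq hω', mul_div_mul_left _ _ hq, ← Real.exp_sub]
  simp only [Function.comp_apply]
  congr 1
  field_simp
  ring

variable {M : EndowedModel A n} (hM : F.IsModel M.model)
  (hprior : IsFullSupport M.model M.prior)

include hM hprior

/-- Compactness of the simplex gives a limit belief along an ultrafilter. Parameters that do not
minimize at `σ'` lose all posterior weight to a better one, and optimality of `a` is a closed
condition. -/
lemma exists_limit_belief {h : ℕ → List (A × Y)} {σ : ℕ → A → ℝ} {σ' : A → ℝ}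
    (hl : ∀ ω ∈ M.model,
      Tendsto (fun t : ℕ => F.logLoss ω (h t) / t - F.wkl (σ t) ω) atTop (𝓝 0))
    {f : Filter ℕ} [f.NeBot] (hf : f ≤ atTop) (hσ : Tendsto σ f (𝓝 σ')) {a : A}
    (ha : ∀ᶠ t in f, a ∈ F.myopicOpt M.model (F.posterior M (h t))) :
    ∃ π ∈ stdSimplex ℝ M.model,
      (∀ ω : M.model, π ω ≠ 0 → (ω : Param n) ∈ F.klMin M.model σ') ∧
      a ∈ F.myopicOpt M.model π := by
  let u : Ultrafilter ℕ := Ultrafilter.of f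
  have huf : (u : Filter ℕ) ≤ f := Ultrafilter.of_le f
  have hmem : Tendsto (fun t => F.posterior M (h t)) u (𝓟 (stdSimplex ℝ M.model)) :=
    tendsto_principal.mpr
      (Eventually.of_forall fun t => F.posterior_mem_stdSimplex hM hprior (h t))
  obtain ⟨π, hπ, hlim⟩ := (isCompact_stdSimplex ℝ M.model).ultrafilter_le_nhds
    (u.map fun t => F.posterior M (h t)) hmem
  have hlim' : Tendsto (fun t => F.posterior M (h t)) u (𝓝 π) := hlim
  refine ⟨π, hπ, fun ω hω => ⟨ω.2, fun ω' hω' => ?_⟩,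
    (F.isClosed_myopicOpt M.model a).mem_of_tendsto hlim' (huf ha)⟩
  by_contra hlt
  refine hω ?_
  have h0 := (F.tendsto_paramLikelihood_div (hM.2 ω.2) (hM.2 hω') (hl ω ω.2) (hl ω' hω') hf hσ
    (not_le.mp hlt)).mono_left huf
  have h1 := h0.const_mul (M.prior ω / M.prior ⟨ω', hω'⟩)
  rw [mul_zero] at h1
  have h2 : Tendsto (fun t => F.posterior M (h t) ω) u (𝓝 0) :=
    squeeze_zero (fun t => (F.posterior_mem_stdSimplex hM hprior (h t)).1 ω)
      (fun t => F.posterior_le hM hprior (h t) ω ⟨ω', hω'⟩) h1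
  exact tendsto_nhds_unique (((continuous_apply ω).tendsto π).comp hlim') h2

/-- If an agent with two actions eventually follows an optimal policy under her model, then the
empirical action frequencies have a Berk-Nash equilibrium as a limit point. -/
theorem exists_isBerkNash_limit (hA : Fintype.card A = 2) {h : ℕ → List (A × Y)} {act : ℕ → A}
    (hl : ∀ ω ∈ M.model, Tendsto (fun t : ℕ => F.logLoss ω (h t) / t -
      F.wkl (fun a => freq (fun s => act s = a) t) ω) atTop (𝓝 0))
    (hact : ∀ᶠ t in atTop, act t ∈ F.myopicOpt M.model (F.posterior M (h t))) :
    ∃ σ : A → ℝ, F.IsBerkNash M.model σ ∧ ∃ f : Filter ℕ, f.NeBot ∧ f ≤ atTop ∧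
      Tendsto (fun t a => freq (fun s => act s = a) t) f (𝓝 σ) := by
  classical
  obtain ⟨a₀, a₁, hne, huniv⟩ := Finset.card_eq_two.mp (Finset.card_univ.trans hA)
  have hcases : ∀ a, a = a₀ ∨ a = a₁ := fun a => by simpa [huniv] using Finset.mem_univ a
  obtain ⟨x, hx0, hx1, hrec1, hrec0⟩ := exists_recurrent_freq fun s => act s = a₁
  let σ : A → ℝ := fun a => if a = a₁ then x else 1 - x
  have hnot : ∀ a, ¬ a = a₁ ↔ a = a₀ := fun a =>
    ⟨fun ha => (hcases a).resolve_right ha, fun ha => ha ▸ hne⟩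
  have hσ1 : σ a₁ = x := if_pos rfl
  have hσ0 : σ a₀ = 1 - x := if_neg hne
  have hσmem : σ ∈ stdSimplex ℝ A := by
    refine ⟨fun a => ?_, ?_⟩
    · simp only [σ]
      split_ifs <;> linarith
    · rw [huniv, Finset.sum_pair hne, hσ0, hσ1]
      ring
  have hlim : ∀ f : Filter ℕ, f ≤ atTop → Tendsto (freq fun s => act s = a₁) f (𝓝 x) →
      Tendsto (fun t a => freq (fun s => act s = a) t) f (𝓝 σ) := by
    intro f hf hfx
    refine tendsto_pi_nhds.mpr fun a => ?_
    rcases hcases a with rfl | rfl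
    · rw [hσ0]
      refine (hfx.const_sub 1).congr' ?_
      filter_upwards [hf (eventually_gt_atTop 0)] with t ht
      rw [← freq_not ht]
      simp_rw [hnot]
    · rwa [hσ1]
  have hb1 : x ≠ 0 → ∃ f : Filter ℕ, f.NeBot ∧ f ≤ atTop ∧
      Tendsto (fun t a => freq (fun s => act s = a) t) f (𝓝 σ) ∧
      ∃ π ∈ stdSimplex ℝ M.model,
      (∀ ω : M.model, π ω ≠ 0 → (ω : Param n) ∈ F.klMin M.model σ) ∧
      a₁ ∈ F.myopicOpt M.model π := by
    intro hx
    obtain ⟨f, hf, hle, hfx, hfb⟩ := exists_filter_of_frequently (hrec1 hx)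
    refine ⟨f, hf, hle, hlim f hle hfx,
      F.exists_limit_belief hM hprior hl hle (hlim f hle hfx) ?_⟩
    filter_upwards [hfb, hle hact] with t h1 h2
    exact h1 ▸ h2
  have hb0 : x ≠ 1 → ∃ f : Filter ℕ, f.NeBot ∧ f ≤ atTop ∧
      Tendsto (fun t a => freq (fun s => act s = a) t) f (𝓝 σ) ∧
      ∃ π ∈ stdSimplex ℝ M.model,
      (∀ ω : M.model, π ω ≠ 0 → (ω : Param n) ∈ F.klMin M.model σ) ∧
      a₀ ∈ F.myopicOpt M.model π := by
    intro hx
    obtain ⟨f, hf, hle, hfx, hfb⟩ := exists_filter_of_frequently (hrec0 hx)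
    refine ⟨f, hf, hle, hlim f hle hfx,
      F.exists_limit_belief hM hprior hl hle (hlim f hle hfx) ?_⟩
    filter_upwards [hfb, hle hact] with t h1 h2
    exact (hnot _).mp h1 ▸ h2
  -- In the corner cases `σ` is supported on one action, which recurs, so a single limit belief
  -- suffices.
  rcases eq_or_ne x 0 with hx | hx
  · obtain ⟨f, hf, hle, hfσ, π, hπ, hsupp, hopt⟩ := hb0 (by rw [hx]; exact zero_ne_one)
    refine ⟨σ, ⟨hσmem, π, hπ, hsupp, fun a ha => ?_⟩, f, hf, hle, hfσ⟩
    rcases hcases a with rfl | rfl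
    · exact hopt
    · exact absurd (hσ1.trans hx) ha
  rcases eq_or_ne x 1 with hx' | hx'
  · obtain ⟨f, hf, hle, hfσ, π, hπ, hsupp, hopt⟩ := hb1 hx
    refine ⟨σ, ⟨hσmem, π, hπ, hsupp, fun a ha => ?_⟩, f, hf, hle, hfσ⟩
    rcases hcases a with rfl | rfl
    · exact absurd (by rw [hσ0, hx', sub_self]) ha
    · exact hopt
  obtain ⟨-, -, -, -, π₀, hπ₀, hsupp₀, hopt₀⟩ := hb0 hx'
  obtain ⟨f, hf, hle, hfσ, π₁, hπ₁, hsupp₁, hopt₁⟩ := hb1 hx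
  refine ⟨σ, ⟨hσmem, ?_⟩, f, hf, hle, hfσ⟩
  have hindiff : ∀ π, F.payoff M.model π a₀ = F.payoff M.model π a₁ →
      ∀ a, a ∈ F.myopicOpt M.model π := by
    intro π hπ a b
    rcases hcases a with rfl | rfl <;> rcases hcases b with rfl | rfl <;> simp [hπ]
  have h₀ : F.payoff M.model π₀ a₁ ≤ F.payoff M.model π₀ a₀ := hopt₀ a₁
  have h₁ : F.payoff M.model π₁ a₀ ≤ F.payoff M.model π₁ a₁ := hopt₁ a₀
  set d₀ := F.payoff M.model π₀ a₀ - F.payoff M.model π₀ a₁ with hd₀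
  set d₁ := F.payoff M.model π₁ a₁ - F.payoff M.model π₁ a₀ with hd₁
  rcases eq_or_lt_of_le (sub_nonneg.mpr h₁) with heq | hlt
  · exact ⟨π₁, hπ₁, hsupp₁, fun a _ => hindiff π₁ (by linarith) a⟩
  have hd₀' : 0 ≤ d₀ := sub_nonneg.mpr h₀
  have hpos : 0 < d₁ + d₀ := by linarith
  -- The payoff advantage of `a₀` is affine in the belief, equal to `d₀` at `π₀` and `-d₁` at `π₁`;
  -- these weights make it zero.
  refine ⟨(d₁ / (d₁ + d₀)) • π₀ + (d₀ / (d₁ + d₀)) • π₁,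
    convex_stdSimplex ℝ M.model hπ₀ hπ₁ (by positivity) (by positivity)
      (by field_simp), fun ω hω => ?_, fun a _ => hindiff _ ?_ a⟩
  · by_cases h1 : π₀ ω = 0
    · refine hsupp₁ ω fun h2 => hω ?_
      simp [h1, h2]
    · exact hsupp₀ ω h1
  · rw [payoff_add_smul, payoff_add_smul]
    field_simp
    rw [hd₀, hd₁]
    ring

end Limits

end ParamFamily

/-! ### Full-support priors close in the Prokhorov metric. -/

section Beliefs

variable {n : ℕ}

lemma beliefMeasure_apply (θ : Finset (Param n)) {π : θ → ℝ} (hπ : ∀ ω, 0 ≤ π ω)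
    {B : Set (Param n)} (hB : MeasurableSet B) :
    beliefMeasure θ π B = ENNReal.ofReal (∑ ω : θ, π ω * B.indicator 1 (ω : Param n)) := by
  have hi : ∀ ω : Param n, (0 : ℝ) ≤ B.indicator 1 ω := fun ω =>
    Set.indicator_nonneg (fun _ _ => zero_le_one) _
  rw [ENNReal.ofReal_sum_of_nonneg fun ω _ => mul_nonneg (hπ ω) (hi ω), beliefMeasure,
    Measure.finsetSum_apply]
  refine Finset.sum_congr rfl fun ω _ => ?_
  rw [Measure.smul_apply, Measure.dirac_apply' _ hB, ENNReal.ofReal_mul (hπ ω), smul_eq_mul]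
  by_cases h : (ω : Param n) ∈ B <;> simp [h]

lemma isProbabilityMeasure_beliefMeasure (θ : Finset (Param n)) {π : θ → ℝ}
    (hπ : π ∈ stdSimplex ℝ θ) : IsProbabilityMeasure (beliefMeasure θ π) :=
  ⟨by
    rw [beliefMeasure_apply θ hπ.1 MeasurableSet.univ]
    simp only [Set.indicator_univ, Pi.one_apply, mul_one]
    rw [hπ.2, ENNReal.ofReal_one]⟩

/-- A full-support belief on a finite set of parameters can be approximated in the Prokhorov metric by
full-support beliefs on any larger finite set. -/
lemma exists_fullSupport_near {θ θ' : Finset (Param n)} (hsub : θ ⊆ θ') {π : θ → ℝ}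
    (hπ : IsFullSupport θ π) (hne : θ.Nonempty) {ε : ℝ} (hε : 0 < ε) :
    ∃ π' : θ' → ℝ, IsFullSupport θ' π' ∧
      levyProkhorovDist (beliefMeasure θ π) (beliefMeasure θ' π') ≤ ε := by
  classical
  let g : Param n → ℝ := fun ω => if h : ω ∈ θ then π ⟨ω, h⟩ else 0
  have hg : ∀ ω : θ, g ω = π ω := fun ω => by simp [g]
  have hg0 : ∀ ω, 0 ≤ g ω := by
    intro ω
    by_cases h : ω ∈ θ
    · simpa [g, h] using (hπ.2 ⟨ω, h⟩).le
    · simp [g, h]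
  have hsum : ∀ f : Param n → ℝ, ∑ ω : θ', g ω * f ω = ∑ ω : θ, π ω * f ω := by
    intro f
    simp_rw [← hg]
    rw [Finset.sum_coe_sort θ' (fun ω => g ω * f ω), Finset.sum_coe_sort θ (fun ω => g ω * f ω)]
    refine (Finset.sum_subset hsub fun ω _ h => ?_).symm
    simp [g, h]
  have hcard : (0 : ℝ) < θ'.card := by exact_mod_cast (hne.mono hsub).card_pos
  set η : ℝ := min (1 / 2) ε with hη
  have hηpos : 0 < η := lt_min (by norm_num) hε
  have hη1 : η < 1 := (min_le_left _ _).trans_lt (by norm_num)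
  -- Mix the prior, extended by zero, with the uniform distribution. No set loses more than mass `η
  -- ≤ ε`, so thickening sets is not even needed.
  let π' : θ' → ℝ := fun ω => (1 - η) * g ω + η / θ'.card
  have hpos : ∀ ω, 0 < π' ω := fun ω =>
    add_pos_of_nonneg_of_pos (mul_nonneg (by linarith) (hg0 ω)) (by positivity)
  have hone : ∑ ω : θ', π' ω = 1 := by
    have h1 := hsum fun _ => 1
    simp only [mul_one] at h1
    simp only [π']
    rw [Finset.sum_add_distrib, ← Finset.mul_sum, h1, hπ.1.2, Finset.sum_const, Finset.card_univ,
      Fintype.card_coe, nsmul_eq_mul]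
    field_simp
    ring
  have hfull : IsFullSupport θ' π' := ⟨⟨fun ω => (hpos ω).le, hone⟩, hpos⟩
  refine ⟨π', hfull, ?_⟩
  have := isProbabilityMeasure_beliefMeasure θ hπ.1
  have := isProbabilityMeasure_beliefMeasure θ' hfull.1
  refine levyProkhorovDist_le_of_forall_le _ _ hε.le fun δ B hδ hB => ?_
  have hthick : B ⊆ Metric.thickening δ B := Metric.self_subset_thickening (hε.trans hδ) B
  refine le_trans ?_ (add_le_add_left (measure_mono hthick) _)
  have hi : ∀ ω : Param n, (0 : ℝ) ≤ B.indicator 1 ω := fun ω =>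
    Set.indicator_nonneg (fun _ _ => zero_le_one) _
  have hi1 : ∀ ω : Param n, B.indicator (1 : Param n → ℝ) ω ≤ 1 := fun ω =>
    Set.indicator_le_self' (fun _ _ => zero_le_one) ω
  rw [beliefMeasure_apply θ hπ.1.1 hB, beliefMeasure_apply θ' hfull.1.1 hB,
    ← ENNReal.ofReal_add (Finset.sum_nonneg fun ω _ => mul_nonneg (hpos ω).le (hi ω))
      (hε.trans hδ).le]
  refine ENNReal.ofReal_le_ofReal ?_
  have hle1 : ∑ ω : θ, π ω * B.indicator 1 (ω : Param n) ≤ 1 := by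
    rw [← hπ.1.2]
    exact Finset.sum_le_sum fun ω _ => mul_le_of_le_one_right (hπ.2 ω).le (hi1 ω)
  have hle2 : (1 - η) * ∑ ω : θ, π ω * B.indicator 1 (ω : Param n) ≤
      ∑ ω : θ', π' ω * B.indicator 1 (ω : Param n) := by
    rw [← hsum, Finset.mul_sum]
    refine Finset.sum_le_sum fun ω _ => ?_
    rw [← mul_assoc]
    exact mul_le_mul_of_nonneg_right (le_add_of_nonneg_right (by positivity)) (hi ω)
  have hηε : η ≤ ε := min_le_right _ _
  nlinarith

end Beliefs

/-! ### Optimal policies and the switching bound. -/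

namespace ParamFamily

variable {A Y : Type*} [MeasurableSpace Y] {𝓔 : Environment A Y} {n : ℕ} (F : ParamFamily 𝓔 n)

/-- Ties go to `a₀`. Robustness speaks of every optimal policy of the competitor, so it has force
only if one exists. -/
lemma exists_isOptimalPolicy [Fintype A] (hA : Fintype.card A = 2) (θ : Finset (Param n)) :
    ∃ p, F.IsOptimalPolicy θ p := by
  classical
  obtain ⟨a₀, a₁, hne, huniv⟩ := Finset.card_eq_two.mp (Finset.card_univ.trans hA)
  have hcases : ∀ a, a = a₀ ∨ a = a₁ := fun a => by simpa [huniv] using Finset.mem_univ a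
  have hmeas : MeasurableSet {π | F.payoff θ π a₁ ≤ F.payoff θ π a₀} :=
    measurableSet_le (F.continuous_payoff θ a₁).measurable (F.continuous_payoff θ a₀).measurable
  refine ⟨fun π => if F.payoff θ π a₁ ≤ F.payoff θ π a₀ then a₀ else a₁, fun a => ?_,
    fun π _ b => ?_⟩
  · rcases hcases a with rfl | rfl
    · convert hmeas using 3 with π
      simp [hne.symm]
    · convert hmeas.compl using 1
      ext π
      simp [hne]
  · dsimp only
    split_ifs with h <;> rcases hcases b with rfl | rfl
    · exact le_rfl
    · exact h
    · exact (not_le.mp h).le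
    · exact le_rfl

lemma action_mem_myopicOpt (α : ℝ) {S : Bool → EndowedModel A n} {m : Bool}
    (hS : F.IsModel (S m).model) (hprior : IsFullSupport (S m).model (S m).prior)
    (hp : F.IsOptimalPolicy (S m).model (S m).policy) {h : List (A × Y)}
    (hm : F.modelChoice α S h = m) :
    F.action α S h ∈ F.myopicOpt (S m).model (F.posterior (S m) h) := by
  subst hm
  exact hp.2 _ (F.posterior_mem_stdSimplex hS hprior h)

lemma likelihood_le_of_modelChoice {α : ℝ} {S : Bool → EndowedModel A n} {x : A × Y}
    {h : List (A × Y)} (hpos : 0 < F.likelihood (S false) (x :: h))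
    (h0 : F.modelChoice α S h = false) (h1 : F.modelChoice α S (x :: h) = false) :
    F.likelihood (S true) (x :: h) ≤ α * F.likelihood (S false) (x :: h) := by
  by_contra hlt
  rw [not_le, ← lt_div_iff₀ hpos] at hlt
  simp [modelChoice, h0, hlt] at h1

/-! ### Compactness of equilibria and failure of persistence. -/

section Equilibria

variable [Fintype A]

/-- Written as complementary-slackness inequalities, the support conditions are closed in the pair
of mixed action and belief. The equilibria are thus a projection of a compact set. -/
lemma isCompact_isBerkNash (θ : Finset (Param n)) : IsCompact {σ | F.IsBerkNash θ σ} := by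
  let K : Set ((A → ℝ) × (θ → ℝ)) := stdSimplex ℝ A ×ˢ stdSimplex ℝ θ ∩
    ((⋂ ω : θ, ⋂ ω' : θ, {x | x.2 ω * (F.wkl x.1 ω - F.wkl x.1 ω') ≤ 0}) ∩
      ⋂ a, ⋂ b, {x | x.1 a * (F.payoff θ x.2 b - F.payoff θ x.2 a) ≤ 0})
  have hK : IsCompact K := by
    refine ((isCompact_stdSimplex ℝ A).prod (isCompact_stdSimplex ℝ θ)).inter_right
      (IsClosed.inter ?_ ?_)
    · refine isClosed_iInter fun ω => isClosed_iInter fun ω' => isClosed_le ?_ continuous_const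
      have h := F.continuous_wkl (ω : Param n)
      have h' := F.continuous_wkl (ω' : Param n)
      fun_prop
    · refine isClosed_iInter fun a => isClosed_iInter fun b => isClosed_le ?_ continuous_const
      have h := F.continuous_payoff θ a
      have h' := F.continuous_payoff θ b
      fun_prop
  have himage : {σ | F.IsBerkNash θ σ} = Prod.fst '' K := by
    ext σ
    constructor
    · rintro ⟨hσ, π, hπ, h1, h2⟩
      refine ⟨(σ, π), ⟨⟨hσ, hπ⟩, ?_, ?_⟩, rfl⟩
      · refine Set.mem_iInter₂.mpr fun ω ω' => ?_
        change π ω * (F.wkl σ ω - F.wkl σ ω') ≤ 0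
        rcases eq_or_ne (π ω) 0 with h | h
        · simp [h]
        · exact mul_nonpos_of_nonneg_of_nonpos (hπ.1 ω) (sub_nonpos.mpr ((h1 ω h).2 ω' ω'.2))
      · refine Set.mem_iInter₂.mpr fun a b => ?_
        change σ a * (F.payoff θ π b - F.payoff θ π a) ≤ 0
        rcases eq_or_ne (σ a) 0 with h | h
        · simp [h]
        · exact mul_nonpos_of_nonneg_of_nonpos (hσ.1 a) (sub_nonpos.mpr (h2 a h b))
    · rintro ⟨⟨σ, π⟩, ⟨⟨hσ, hπ⟩, h1, h2⟩, rfl⟩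
      have h1' : ∀ ω ω' : θ, π ω * (F.wkl σ ω - F.wkl σ ω') ≤ 0 :=
        fun ω ω' => Set.mem_iInter₂.mp h1 ω ω'
      have h2' : ∀ a b, σ a * (F.payoff θ π b - F.payoff θ π a) ≤ 0 :=
        fun a b => Set.mem_iInter₂.mp h2 a b
      refine ⟨hσ, π, hπ, fun ω hω => ⟨ω.2, fun ω' hω' => ?_⟩, fun a ha b => ?_⟩
      · have hpos : 0 < π ω := lt_of_le_of_ne (hπ.1 ω) (Ne.symm hω)
        exact sub_nonpos.mp (nonpos_of_mul_nonpos_right (h1' ω ⟨ω', hω'⟩) hpos)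
      · have hpos : 0 < σ a := lt_of_le_of_ne (hσ.1 a) (Ne.symm ha)
        exact sub_nonpos.mp (nonpos_of_mul_nonpos_right (h2' a b) hpos)
  rw [himage]
  exact hK.image continuous_fst

/-- If `θ` is not locally KL-minimizing at `σ`, some nearby parameter of the family has a smaller
divergence at `σ` than all parameters of `θ`. -/
lemma exists_wkl_lt {θ : Finset (Param n)} (hθ : F.IsModel θ) {σ : A → ℝ}
    (hσ : ¬ F.IsLocallyKLMinimizing θ σ) {ε : ℝ} (hε : 0 < ε) :
    ∃ ω' ∈ F.params, (∃ ω ∈ θ, dist ω' ω < ε) ∧ ∀ ω ∈ θ, F.wkl σ ω' < F.wkl σ ω := by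
  simp only [IsLocallyKLMinimizing, not_exists, not_and, not_forall, not_le] at hσ
  obtain ⟨ω, hω, ω', hω', hlt⟩ := hσ ε hε
  obtain ⟨z, hz, hdist⟩ := Metric.mem_thickening_iff.mp hω'.2
  refine ⟨ω', hω'.1, ⟨z, hz.1, hdist⟩, fun ω'' hω'' => ?_⟩
  have hle : F.wkl σ ω ≤ F.wkl σ ω'' := hω.2 ω'' hω''
  simp_rw [F.integral_log_div_eq _ (hθ.2 hω.1) hω'.1, mul_sub] at hlt
  rw [Finset.sum_sub_distrib] at hlt
  exact (sub_pos.mp hlt).trans_le hle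

lemma exists_isBerkNash (hA : Fintype.card A = 2) {M : EndowedModel A n}
    (hM : F.IsModel M.model) (hprior : IsFullSupport M.model M.prior)
    (hp : F.IsOptimalPolicy M.model M.policy) : ∃ σ : A → ℝ, F.IsBerkNash M.model σ := by
  -- A switcher between two copies of `M` always follows `M`, whatever the threshold; `1` is
  -- arbitrary.
  have hl := (ae_ball_iff M.model.countable_toSet).mpr fun ω hω =>
    F.ae_tendsto_logLoss 1 (fun _ => M) (fun _ => hM) (fun _ => hp) (hM.2 hω)
  obtain ⟨y, hy⟩ := hl.exists
  obtain ⟨σ, hσ, -⟩ := F.exists_isBerkNash_limit hM hprior hA hy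
    (Eventually.of_forall fun t => hp.2 _ (F.posterior_mem_stdSimplex hM hprior _))
  exact ⟨σ, hσ⟩

/-- A model almost surely does not prevail against a competing model that contains, for every
Berk-Nash equilibrium, a parameter with a smaller divergence. -/
theorem not_persists (hA : Fintype.card A = 2) {α : ℝ} {S : Bool → EndowedModel A n}
    (hS : ∀ m, F.IsModel (S m).model)
    (hprior : ∀ m, IsFullSupport (S m).model (S m).prior)
    (hp : ∀ m, F.IsOptimalPolicy (S m).model (S m).policy)
    (hbetter : ∀ σ : A → ℝ, F.IsBerkNash (S false).model σ →
      ∃ ω' ∈ (S true).model, ∀ ω ∈ (S false).model, F.wkl σ ω' < F.wkl σ ω) :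
    ¬ F.Persists α S := by
  -- Persistence compares parameter sets, so equal sets would make it trivial. They differ because
  -- an equilibrium exists, and the better parameter there cannot beat itself.
  have hmodel : (S true).model ≠ (S false).model := by
    intro heq
    obtain ⟨σ, hσ⟩ := F.exists_isBerkNash hA (hS false) (hprior false) (hp false)
    obtain ⟨ω', hω', hlt⟩ := hbetter σ hσ
    exact lt_irrefl _ (hlt ω' (heq ▸ hω'))
  have hae : ∀ᵐ y ∂𝓔.prob, ∀ m, ∀ ω ∈ (S m).model,
      Tendsto (fun t : ℕ => F.logLoss ω (F.history α S y t) / t -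
        F.wkl (fun a => freq (fun s => F.act α S y s = a) t) ω) atTop (𝓝 0) :=
    ae_all_iff.mpr fun m => (ae_ball_iff (S m).model.countable_toSet).mpr fun ω hω =>
      F.ae_tendsto_logLoss α S hS hp ((hS m).2 hω)
  unfold Persists
  rw [not_lt, nonpos_iff_eq_zero]
  refine measure_mono_null ?_ (ae_iff.mp hae)
  rintro y ⟨T, hT⟩ hy
  have hchoice : ∀ t ≥ T, F.modelChoice α S (F.history α S y t) = false := by
    intro t ht
    by_contra h
    exact hmodel (by simpa [Bool.eq_true_of_not_eq_false h] using hT t ht)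
  obtain ⟨σ, hσ, f, hf, hle, hlim⟩ := F.exists_isBerkNash_limit (hS false) (hprior false) hA
    (hy false) (eventually_atTop.mpr ⟨T, fun t ht =>
      F.action_mem_myopicOpt α (hS false) (hprior false) (hp false) (hchoice t ht)⟩)
  obtain ⟨ω', hω', hlt⟩ := hbetter σ hσ
  have hω'p : ω' ∈ F.params := (hS true).2 hω'
  have hratio : Tendsto (fun t => ∑ ω : (S false).model, (S false).prior ω *
      (F.paramLikelihood ω (F.history α S y t) /
        F.paramLikelihood ω' (F.history α S y t))) f (𝓝 0) := by
    have h := tendsto_finsetSum Finset.univ fun (ω : (S false).model) _ =>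
      (F.tendsto_paramLikelihood_div ((hS false).2 ω.2) hω'p (hy false ω ω.2) (hy true ω' hω')
        hle hlim (hlt ω ω.2)).const_mul ((S false).prior ω)
    simpa using h
  -- Not switching keeps the competitor's likelihood below `α` times that of `θ`. Dividing by the
  -- likelihood of `ω'` bounds its positive prior weight by a quantity tending to zero.
  have hbound : ∀ᶠ t in f, (S true).prior ⟨ω', hω'⟩ ≤
      α * ∑ ω : (S false).model, (S false).prior ω *
      (F.paramLikelihood ω (F.history α S y t) / F.paramLikelihood ω' (F.history α S y t)) := by
    filter_upwards [hle (eventually_ge_atTop (T + 1))] with t ht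
    -- The bound needs the initial model both before and after the update, hence `T + 1`.
    obtain ⟨s, rfl⟩ : ∃ s, t = s + 1 := ⟨t - 1, by omega⟩
    set h := F.history α S y (s + 1) with hh
    have h1 : F.likelihood (S true) h ≤ α * F.likelihood (S false) h :=
      F.likelihood_le_of_modelChoice (F.likelihood_pos (hS false) (hprior false) h)
        (hchoice s (by omega)) (hchoice (s + 1) (by omega))
    have hpos := F.paramLikelihood_pos hω'p h
    have h2 : (S true).prior ⟨ω', hω'⟩ * F.paramLikelihood ω' h ≤ F.likelihood (S true) h :=
      Finset.single_le_sum
        (f := fun ω : (S true).model => (S true).prior ω * F.paramLikelihood ω h)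
        (fun ω _ => mul_nonneg ((hprior true).2 ω).le
          (F.paramLikelihood_pos ((hS true).2 ω.2) h).le)
        (Finset.mem_univ (⟨ω', hω'⟩ : (S true).model))
    have h3 : ∑ ω : (S false).model, (S false).prior ω *
        (F.paramLikelihood ω h / F.paramLikelihood ω' h) =
        F.likelihood (S false) h / F.paramLikelihood ω' h := by
      simp_rw [← mul_div_assoc]
      rw [← Finset.sum_div]
      rfl
    rw [h3, ← mul_div_assoc, le_div_iff₀ hpos]
    exact h2.trans h1
  have hzero := ge_of_tendsto (hratio.const_mul α) hbound
  rw [mul_zero] at hzero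
  exact absurd ((hprior true).2 ⟨ω', hω'⟩) (not_lt.mpr hzero)

end Equilibria

end ParamFamily

end

/-! ### Construction of the competing model. -/

theorem theorem7 {A Y : Type*} [Fintype A] [MeasurableSpace Y] (hA : Fintype.card A = 2)
    (𝓔 : Environment A Y) {n : ℕ} (F : ParamFamily 𝓔 n) (α : ℝ) (hα : 1 < α)
    (θ : Finset (Param n)) (hθ : F.IsModel θ) (hrobust : F.IsConstrainedLocallyRobust α θ) :
    ∃ σ : A → ℝ, F.IsBerkNash θ σ ∧ F.IsLocallyKLMinimizing θ σ := by
  classical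
  by_contra! hcon
  obtain ⟨ε, hε, π, hπ, p, hp, hpersist⟩ := hrobust
  let ι := {ω' : Param n // ω' ∈ F.params ∧ ∃ ω ∈ θ, dist ω' ω < ε}
  let U : ι → Set (A → ℝ) := fun ω' => {σ | ∀ ω ∈ θ, F.wkl σ ω' < F.wkl σ ω}
  have hU : ∀ ω', IsOpen (U ω') := by
    intro ω'
    have : U ω' = ⋂ ω ∈ θ, {σ | F.wkl σ ω' < F.wkl σ ω} := by
      ext σ
      simp [U]
    rw [this]
    exact isOpen_biInter_finset fun ω _ => isOpen_lt (F.continuous_wkl _) (F.continuous_wkl _)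
  -- Competing models are finite, so a finite subcover is required.
  obtain ⟨W, hW⟩ := (F.isCompact_isBerkNash θ).elim_finite_subcover U hU fun σ hσ => by
    obtain ⟨ω', h1, h2, h3⟩ := F.exists_wkl_lt hθ (hcon σ hσ) hε
    exact Set.mem_iUnion.mpr ⟨⟨ω', h1, h2⟩, h3⟩
  -- Keeping `θ` inside the competitor makes both its parameter set and a suitable prior close to
  -- the original ones.
  let θ' : Finset (Param n) := θ ∪ W.image Subtype.val
  have hsub : θ ⊆ θ' := Finset.subset_union_left
  have hθ' : F.IsModel θ' := by
    refine ⟨hθ.1.mono hsub, fun ω hω => ?_⟩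
    rcases Finset.mem_union.mp hω with h | h
    · exact hθ.2 h
    · obtain ⟨ω', -, rfl⟩ := Finset.mem_image.mp h
      exact ω'.2.1
  have hdist : Metric.hausdorffDist (θ : Set (Param n)) (θ' : Set (Param n)) ≤ ε := by
    refine Metric.hausdorffDist_le_of_mem_dist hε.le
      (fun ω hω => ⟨ω, hsub hω, (dist_self ω).trans_le hε.le⟩) fun ω hω => ?_
    rcases Finset.mem_union.mp hω with h | h
    · exact ⟨ω, h, (dist_self ω).trans_le hε.le⟩
    · obtain ⟨ω', -, rfl⟩ := Finset.mem_image.mp h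
      obtain ⟨z, hz, hlt⟩ := ω'.2.2
      exact ⟨z, hz, hlt.le⟩
  obtain ⟨π', hπ', hLP⟩ := exists_fullSupport_near hsub hπ hθ.1 hε
  obtain ⟨p', hp'⟩ := F.exists_isOptimalPolicy hA θ'
  refine F.not_persists hA ?_ ?_ ?_ ?_ (hpersist θ' hθ' hdist π' hπ' hLP p' hp')
  · rintro (_ | _)
    · exact hθ
    · exact hθ'
  · rintro (_ | _)
    · exact hπ
    · exact hπ'
  · rintro (_ | _)
    · exact hp
    · exact hp'
  · intro σ hσ
    obtain ⟨ω', hω', hlt⟩ := Set.mem_iUnion₂.mp (hW hσ)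
    exact ⟨ω', Finset.mem_union_right _ (Finset.mem_image_of_mem _ hω'), hlt⟩
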